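/- Fix a space of datasets $\mathcal{D}$ and two distinct datasets $D_1, D_2 \in \mathcal{D}$. For probability measures $P, Q$ on a common measurable space, $\operatorname{PLD}(P\|Q)$ is the law, on $\mathbb{R}\cup\{\infty\}$, of $\log\frac{dP}{dQ}(\omega)$ for $\omega\sim P$ (the likelihood ratio being taken with respect to a common dominating measure, with value $\infty$ where the density of $Q$ vanishes); a PLD is a law of this form, and for a mechanism $M$ we put $\operatorname{PLD}(M)=\operatorname{PLD}(M(D_1)\|M(D_2))$. For PLDs, $L\preceq L'$ means that there are pairs with $L=\operatorname{PLD}(P\|Q)$, $L'=\operatorname{PLD}(P'\|Q')$ and a Markov kernel sending $P'$ to $P$ and $Q'$ to $Q$; $\sup$ denotes the least upper bound among PLDs for $\preceq$, $\oplus$ denotes convolution, and $\mathrm{Id}$ is the point mass at $0$. Let $\mathcal{L}$ be a family of PLDs with $\mathrm{Id}\in\mathcal{L}$, let $B$ be a PLD, and let $k$ be a positive integer. The natural filter for $k$ queries in $\mathcal{L}$ with budget $B$ interacts with an adaptive analyst for at most $k$ rounds, until the analyst stops. In round $i$ the analyst, depending on the transcript of the previous rounds, issues a mechanism whose PLD $L_i$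 lies in $\mathcal{L}$; the filter answers with a sample $Y_i$ of this mechanism if $L_1\oplus\dots\oplus L_i\preceq B$, where $L_1,\dots,L_i$ are the PLDs of all queries issued so far, and gives no answer otherwise. (The spaces of answers are arbitrary measurable spaces, the mechanisms are Markov kernels in the previous transcript, and in each round the set of transcripts after which an answer is given is assumed measurable, so that the interaction is itself a mechanism.) The filter is called free if, for every such analyst, the mechanism that outputs the transcript of the interaction has PLD $\preceq B$. Set $V_0(L_1,\dots,L_k):=\mathrm{Id}$ and, for $0\le k'<k$ and $L_1,\dots,L_{k'}\in\mathcal{L}$ with $L_1\oplus\dots\oplus L_{k'}\preceq B$, $$V_{k-k'}(L_1,\dots,L_{k'}):=\sup\bigl\{L\oplus V_{k-k'-1}(L_1,\dots,L_{k'},L) : L\in\mathcal{L},\ L_1\oplus\dots\oplus L_{k'}\oplus L\preceq B\bigr\}.$$ Theorem. All these suprema exist, and the natural filter for $k$ queries in $\mathcal{L}$ with budget $B$ is free if and only if $V_k(\lambda)\preceq B$, where $\lambda$ is the empty sequence. -/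

import Mathlib

open MeasureTheory ProbabilityTheory

universe u v

noncomputable section

namespace Privacy

/-! ### Privacy loss distributions and the Blackwell order -/

/-- The log-likelihood ratio `log (dP/dQ)` of two distributions, computed with respect to the
dominating measure `P + Q`. It takes the value `∞` where only `dQ/d(P+Q)` vanishes. -/
def privacyLoss {Ω : Type u} [MeasurableSpace Ω] (P Q : Measure Ω) (ω : Ω) : EReal :=
  ENNReal.log (P.rnDeriv (P + Q) ω / Q.rnDeriv (P + Q) ω)

/-- The privacy loss distribution `PLD(P ‖ Q)`: the law of `log (dP/dQ)(ω)` for `ω ∼ P`.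
It is a measure on `[-∞, ∞]` that gives no mass to `-∞`. -/
def pld {Ω : Type u} [MeasurableSpace Ω] (P Q : Measure Ω) : Measure EReal :=
  P.map (privacyLoss P Q)

/-- A measure on `[-∞, ∞]` is a PLD if it is the PLD of some pair of distributions. -/
def IsPLD (L : Measure EReal) : Prop :=
  ∃ (Ω : Type) (_ : MeasurableSpace Ω) (P Q : Measure Ω),
    IsProbabilityMeasure P ∧ IsProbabilityMeasure Q ∧ L = pld P Q

/-- The Blackwell order on pairs: `(P, Q) ⪯ (P', Q')` if some Markov kernel sends `P'` to `P`
and `Q'` to `Q`. -/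
def PairLE {Ω Ω' : Type u} [MeasurableSpace Ω] [MeasurableSpace Ω']
    (P Q : Measure Ω) (P' Q' : Measure Ω') : Prop :=
  ∃ φ : Kernel Ω' Ω, IsMarkovKernel φ ∧ P = P'.bind φ ∧ Q = Q'.bind φ

/-- The Blackwell order on PLDs: `L ⪯ L'` if `L` and `L'` are the PLDs of some pairs
`(P, Q) ⪯ (P', Q')`. -/
def PLDLE (L L' : Measure EReal) : Prop :=
  ∃ (Ω Ω' : Type) (_ : MeasurableSpace Ω) (_ : MeasurableSpace Ω')
    (P Q : Measure Ω) (P' Q' : Measure Ω'),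
    IsProbabilityMeasure P ∧ IsProbabilityMeasure Q ∧
    IsProbabilityMeasure P' ∧ IsProbabilityMeasure Q' ∧
    L = pld P Q ∧ L' = pld P' Q' ∧ PairLE P Q P' Q'

/-- The PLD that is identically zero. -/
def idPLD : Measure EReal := Measure.dirac 0

/-- The convolution `L₁ ⊕ ⋯ ⊕ Lₙ` of a list of PLDs; the empty convolution is `Id`. -/
def convList (l : List (Measure EReal)) : Measure EReal :=
  l.foldl Measure.conv idPLD

/-- `S` is a least upper bound, among the PLDs, of the family `F`. -/
def IsPLDSup (F : Set (Measure EReal)) (S : Measure EReal) : Prop :=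
  IsPLD S ∧ (∀ L ∈ F, PLDLE L S) ∧
    ∀ U, IsPLD U → (∀ L ∈ F, PLDLE L U) → PLDLE S U

open Classical in
/-- The supremum of a family of PLDs (`Id` if there is none). -/
def pldSup (F : Set (Measure EReal)) : Measure EReal :=
  if h : ∃ S, IsPLDSup F S then h.choose else idPLD

/-! ### The value recursion -/

/-- The next queries that the budget `B` admits after the queries `l = (L₁, …, Lₖ')`:
all `L ∈ 𝓛` with `L₁ ⊕ ⋯ ⊕ Lₖ' ⊕ L ⪯ B`. -/
def admissible (𝓛 : Set (Measure EReal)) (B : Measure EReal) (l : List (Measure EReal)) :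
    Set (Measure EReal) :=
  {L | L ∈ 𝓛 ∧ PLDLE ((convList l).conv L) B}

/-- `value 𝓛 B n (L₁, …, Lₖ')` is `Vₙ(L₁, …, Lₖ')`, where `n` is the number of queries left. -/
def value (𝓛 : Set (Measure EReal)) (B : Measure EReal) :
    ℕ → List (Measure EReal) → Measure EReal
  | 0, _ => idPLD
  | n + 1, l => pldSup {R | ∃ L ∈ admissible 𝓛 B l, R = L.conv (value 𝓛 B n (l ++ [L]))}

/-! ### The natural filter -/

/-- The transcript of the first `n` rounds: in round `i` either an answer in `Y i`, or the
symbol `()` that no answer was given. -/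
def Transcript (Y : ℕ → Type u) : ℕ → Type u
  | 0 => PUnit
  | n + 1 => Transcript Y n × (Y n ⊕ Unit)

instance instMeasurableSpaceTranscript (Y : ℕ → Type u) [∀ i, MeasurableSpace (Y i)] :
    ∀ n, MeasurableSpace (Transcript Y n)
  | 0 => (inferInstance : MeasurableSpace PUnit)
  | n + 1 =>
    letI := instMeasurableSpaceTranscript Y n
    (inferInstance : MeasurableSpace (Transcript Y n × (Y n ⊕ Unit)))

/-- An adaptive analyst that issues queries in `𝓛`, for mechanisms on the dataset space `𝓓` whose
privacy is measured at the pair `(D₁, D₂)`. Given the transcript of the rounds before round `i`,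
the analyst either stops or issues the mechanism `query i`, whose PLD lies in `𝓛`. -/
structure Analyst {𝓓 : Type v} (D₁ D₂ : 𝓓) (𝓛 : Set (Measure EReal)) where
  /-- the space of answers to the query of round `i` -/
  Y : ℕ → Type u
  [measurableSpace : ∀ i, MeasurableSpace (Y i)]
  /-- the transcripts at which the analyst continues with round `i` -/
  continues : ∀ i, Set (Transcript Y i)
  /-- the mechanism issued in round `i` -/
  query : ∀ i, 𝓓 → Kernel (Transcript Y i) (Y i)
  [isMarkov : ∀ i D, IsMarkovKernel (query i D)]
  query_mem : ∀ i y, pld (query i D₁ y) (query i D₂ y) ∈ 𝓛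

namespace Analyst

attribute [instance] Analyst.measurableSpace Analyst.isMarkov

variable {𝓓 : Type v} {D₁ D₂ : 𝓓} {𝓛 : Set (Measure EReal)}

/-- The PLD of the query issued in round `i` after the transcript `y`. -/
def queryPLD (A : Analyst.{u, v} D₁ D₂ 𝓛) (i : ℕ) (y : Transcript A.Y i) : Measure EReal :=
  pld (A.query i D₁ y) (A.query i D₂ y)

/-- The PLDs of the queries issued in the rounds recorded in a transcript, in order. -/
def issued (A : Analyst.{u, v} D₁ D₂ 𝓛) : (i : ℕ) → Transcript A.Y i → List (Measure EReal)
  | 0, _ => []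
  | i + 1, y => A.issued i y.1 ++ [A.queryPLD i y.1]

/-- The analyst has not stopped, and goes on with round `i`. -/
def running (A : Analyst.{u, v} D₁ D₂ 𝓛) : (i : ℕ) → Transcript A.Y i → Prop
  | 0, y => y ∈ A.continues 0
  | i + 1, y => A.running i y.1 ∧ y ∈ A.continues (i + 1)

/-- The transcripts after which the filter with budget `B` answers the query of round `i`: the
analyst is still running, and the convolution of the PLDs of all queries issued so far,
including the present one, is dominated by `B`. -/
def answered (A : Analyst.{u, v} D₁ D₂ 𝓛) (B : Measure EReal) (i : ℕ) :
    Set (Transcript A.Y i) :=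
  {y | A.running i y ∧ PLDLE (convList (A.issued i y ++ [A.queryPLD i y])) B}

/-- The decisions of the filter are events, so that the interaction is a mechanism. -/
def MeasurableDecisions (A : Analyst.{u, v} D₁ D₂ 𝓛) (B : Measure EReal) : Prop :=
  ∀ i, MeasurableSet (A.answered B i)

open Classical in
/-- The law of what the analyst receives in round `i` on the dataset `D`: a sample of the query if
the filter answers it, and the symbol `()` otherwise. -/
def response (A : Analyst.{u, v} D₁ D₂ 𝓛) (B : Measure EReal) (hA : A.MeasurableDecisions B)
    (D : 𝓓) (i : ℕ) : Kernel (Transcript A.Y i) (A.Y i ⊕ Unit) :=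
  Kernel.piecewise (hA i) ((A.query i D).map Sum.inl) (Kernel.const _ (Measure.dirac (Sum.inr ())))

/-- The mechanism induced by the interaction of the analyst with the natural filter of budget `B`
and query capacity `k`: the law of the transcript on the dataset `D`. -/
def interaction (A : Analyst.{u, v} D₁ D₂ 𝓛) (B : Measure EReal) (hA : A.MeasurableDecisions B)
    (D : 𝓓) : (k : ℕ) → Measure (Transcript A.Y k)
  | 0 => Measure.dirac PUnit.unit
  | k + 1 => (A.interaction B hA D k).compProd (A.response B hA D k)

end Analyst

/-- The natural filter for `k` queries in `𝓛` with budget `B` is free: its interaction with any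
analyst has a PLD dominated by `B`. -/
def NaturalFilterFree {𝓓 : Type v} (D₁ D₂ : 𝓓) (𝓛 : Set (Measure EReal)) (B : Measure EReal)
    (k : ℕ) : Prop :=
  ∀ (A : Analyst.{u, v} D₁ D₂ 𝓛) (hA : A.MeasurableDecisions B),
    PLDLE (pld (A.interaction B hA D₁ k) (A.interaction B hA D₂ k)) B

end Privacy

end

noncomputable section

namespace Privacy

open scoped ENNReal unitInterval Topology

/-! ### Bayes risk of a pair of distributions -/

section Densities

variable {Ω : Type u} [MeasurableSpace Ω]

/-! Everything is read off from the function `risk L`, the least weighted error in testing `P`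
against `Q`. Blackwell's theorem (`pldLE_iff_risk_le`) says that `L ⪯ L'` exactly when `risk L' ≤
risk L` at all finite weights. One direction pulls a test back along the kernel. For the other, a
pair is replaced by the law `ν` on the unit interval of the density of `P` with respect to `P + Q`.
Up to an affine change the risk is then the hinge integral `∫ min x c dν`, and an inequality of
hinge integrals is the concave order of posteriors. Strassen's theorem
(`exists_martingale_coupling`, by Hahn–Banach and Riesz) gives a martingale coupling, whose
disintegration is the kernel.

Suprema exist (`exists_isPLDSup`) because an infimum of hinge integrals of posteriors is again
concave with the same behaviour outside the unit interval, and `exists_hinge_mixture` turns such a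
function into the hinge integral of a posterior.

Observing a loss `z` replaces the weight `γ` by `γ exp (-z)`, so convolution averages risks at
updated weights (`IsPLD.risk_conv`). The value recursion is therefore dynamic programming for an
analyst who tries to tell the two datasets apart. Backward induction (`risk_value_le`) shows that no
analyst beats the value; once an answer is withheld none follows, so nothing more is learned. This
gives freeness when the value is within the budget. Conversely, for each `γ` and `ε` some strategy
with some test comes within `ε` of the risk of the value (`exists_strategy`). Continuations are
chosen on a countable partition of the updated weights, which avoids measurable selection, and the
Lipschitz bound `risk_add_le` controls the discretization. Freeness bounds the risk of `B` by these
errors. -/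

lemma withDensity_rnDeriv_add_left (P Q : Measure Ω) [IsFiniteMeasure P] [IsFiniteMeasure Q] :
    (P + Q).withDensity (P.rnDeriv (P + Q)) = P :=
  Measure.withDensity_rnDeriv_eq _ _ (Measure.AbsolutelyContinuous.rfl.add_right _)

lemma withDensity_rnDeriv_add_right (P Q : Measure Ω) [IsFiniteMeasure P] [IsFiniteMeasure Q] :
    (P + Q).withDensity (Q.rnDeriv (P + Q)) = Q :=
  Measure.withDensity_rnDeriv_eq _ _ (Measure.AbsolutelyContinuous.rfl.add_right' _)

lemma rnDeriv_add_rnDeriv_eq_one (P Q : Measure Ω) [IsFiniteMeasure P] [IsFiniteMeasure Q] :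
    ∀ᵐ ω ∂(P + Q), P.rnDeriv (P + Q) ω + Q.rnDeriv (P + Q) ω = 1 := by
  filter_upwards [P.rnDeriv_add' Q (P + Q), (P + Q).rnDeriv_self] with ω h1 h2
  rw [h1] at h2
  exact h2

lemma lintegral_left (P Q : Measure Ω) [IsFiniteMeasure P] [IsFiniteMeasure Q]
    {h : Ω → ℝ≥0∞} (hh : Measurable h) :
    ∫⁻ ω, h ω ∂P = ∫⁻ ω, P.rnDeriv (P + Q) ω * h ω ∂(P + Q) := by
  conv_lhs => rw [← withDensity_rnDeriv_add_left P Q]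
  rw [lintegral_withDensity_eq_lintegral_mul _ (Measure.measurable_rnDeriv _ _) hh]
  rfl

lemma lintegral_right (P Q : Measure Ω) [IsFiniteMeasure P] [IsFiniteMeasure Q]
    {h : Ω → ℝ≥0∞} (hh : Measurable h) :
    ∫⁻ ω, h ω ∂Q = ∫⁻ ω, Q.rnDeriv (P + Q) ω * h ω ∂(P + Q) := by
  conv_lhs => rw [← withDensity_rnDeriv_add_right P Q]
  rw [lintegral_withDensity_eq_lintegral_mul _ (Measure.measurable_rnDeriv _ _) hh]
  rfl

lemma measurable_privacyLoss (P Q : Measure Ω) : Measurable (privacyLoss P Q) :=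
  ((Measure.measurable_rnDeriv _ _).div (Measure.measurable_rnDeriv _ _)).ennreal_log

instance isProbabilityMeasure_pld (P Q : Measure Ω) [IsProbabilityMeasure P] :
    IsProbabilityMeasure (pld P Q) :=
  Measure.isProbabilityMeasure_map (measurable_privacyLoss P Q).aemeasurable

/-- The likelihood ratio `dQ/dP` is `exp` of minus the privacy loss. -/
lemma exp_neg_privacyLoss (P Q : Measure Ω) [IsFiniteMeasure P] [IsFiniteMeasure Q] :
    ∀ᵐ ω ∂(P + Q), EReal.exp (-privacyLoss P Q ω)
      = Q.rnDeriv (P + Q) ω / P.rnDeriv (P + Q) ω := by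
  filter_upwards [rnDeriv_add_rnDeriv_eq_one P Q] with ω h
  rw [privacyLoss, EReal.exp_neg, ENNReal.exp_log, ENNReal.inv_div]
  · exact Or.inl (ne_top_of_le_ne_top ENNReal.one_ne_top (h ▸ le_add_self))
  · by_contra! hc
    simp [hc.1, hc.2] at h

end Densities

/-- The least value of `P Aᶜ + γ Q A` over events `A`, where `L = PLD(P ‖ Q)`: the Bayes risk in
testing `P` against `Q` with weights `1` and `γ`. -/
def risk (L : Measure EReal) (γ : ℝ≥0∞) : ℝ≥0∞ := ∫⁻ z, min 1 (γ * EReal.exp (-z)) ∂L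

lemma measurable_exp_neg : Measurable fun z : EReal => EReal.exp (-z) :=
  EReal.measurable_exp.comp measurable_neg

lemma risk_mono (L : Measure EReal) : Monotone (risk L) := fun a b h => by
  unfold risk; gcongr

lemma measurable_risk (L : Measure EReal) : Measurable (risk L) := (risk_mono L).measurable

lemma risk_le_min (L : Measure EReal) [IsProbabilityMeasure L]
    (hL : ∫⁻ z, EReal.exp (-z) ∂L ≤ 1) (γ : ℝ≥0∞) : risk L γ ≤ min 1 γ := by
  refine le_min ?_ ?_
  · calc risk L γ ≤ ∫⁻ _, 1 ∂L := lintegral_mono fun z => min_le_left _ _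
      _ = 1 := by simp
  · calc risk L γ ≤ ∫⁻ z, γ * EReal.exp (-z) ∂L := lintegral_mono fun z => min_le_right _ _
      _ = γ * ∫⁻ z, EReal.exp (-z) ∂L := lintegral_const_mul _ measurable_exp_neg
      _ ≤ γ * 1 := by gcongr
      _ = γ := mul_one _

/-- The risk is 1-Lipschitz in the weight because the likelihood ratio has mean at most one. This is
what allows weights to be rounded in `lintegral_oddsCell_le`. -/
lemma risk_add_le (L : Measure EReal) (hL : ∫⁻ z, EReal.exp (-z) ∂L ≤ 1) (γ δ : ℝ≥0∞) :
    risk L (γ + δ) ≤ risk L γ + δ := by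
  calc risk L (γ + δ) ≤ ∫⁻ z, (min 1 (γ * EReal.exp (-z)) + δ * EReal.exp (-z)) ∂L := by
        refine lintegral_mono fun z => ?_
        simp only
        rw [add_mul, ← min_add_add_right]
        exact min_le_min_right _ le_self_add
    _ = risk L γ + δ * ∫⁻ z, EReal.exp (-z) ∂L := by
        rw [lintegral_add_right _ (measurable_exp_neg.const_mul _),
          lintegral_const_mul _ measurable_exp_neg]
        rfl
    _ ≤ risk L γ + δ * 1 := by gcongr
    _ = _ := by rw [mul_one]

lemma risk_idPLD (γ : ℝ≥0∞) : risk idPLD γ = min 1 γ := by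
  unfold risk idPLD
  rw [lintegral_dirac]
  simp

section Risk

variable {Ω : Type u} [MeasurableSpace Ω] (P Q : Measure Ω)

lemma lintegral_pld {h : EReal → ℝ≥0∞} (hh : Measurable h) :
    ∫⁻ z, h z ∂(pld P Q) = ∫⁻ ω, h (privacyLoss P Q ω) ∂P :=
  lintegral_map hh (measurable_privacyLoss P Q)

variable [IsFiniteMeasure P] [IsFiniteMeasure Q]

lemma risk_pld (γ : ℝ≥0∞) :
    risk (pld P Q) γ
      = ∫⁻ ω, min (P.rnDeriv (P + Q) ω) (γ * Q.rnDeriv (P + Q) ω) ∂(P + Q) := by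
  have hm : Measurable fun z : EReal => min 1 (γ * EReal.exp (-z)) :=
    measurable_const.min (measurable_exp_neg.const_mul _)
  rw [risk, lintegral_pld P Q hm]
  refine (lintegral_left P Q (hm.comp (measurable_privacyLoss P Q))).trans
    (lintegral_congr_ae ?_)
  filter_upwards [exp_neg_privacyLoss P Q, rnDeriv_add_rnDeriv_eq_one P Q] with ω h1 h2
  rw [Function.comp_apply, h1]
  have ht : P.rnDeriv (P + Q) ω ≠ ∞ := ne_top_of_le_ne_top ENNReal.one_ne_top (h2 ▸ le_self_add)
  rcases eq_or_ne (P.rnDeriv (P + Q) ω) 0 with h0 | h0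
  · simp [h0]
  · rw [mul_min, mul_one, mul_left_comm, ENNReal.mul_div_cancel h0 ht]

/-- The integral of `dQ/dP` against `P` misses only the part of `Q` that is singular to `P`. -/
lemma lintegral_exp_neg_pld_le : ∫⁻ z, EReal.exp (-z) ∂(pld P Q) ≤ Q Set.univ := by
  rw [lintegral_pld P Q measurable_exp_neg]
  refine (lintegral_left P Q (measurable_exp_neg.comp (measurable_privacyLoss P Q))).trans_le ?_
  calc _ ≤ ∫⁻ ω, Q.rnDeriv (P + Q) ω ∂(P + Q) := by
        refine lintegral_mono_ae ?_
        filter_upwards [exp_neg_privacyLoss P Q] with ω h1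
        rw [Function.comp_apply, h1]
        exact ENNReal.mul_div_le
    _ ≤ Q Set.univ := Measure.lintegral_rnDeriv_le

lemma pld_ae_ne_bot : ∀ᵐ z ∂(pld P Q), z ≠ ⊥ := by
  refine ae_iff.2 (le_antisymm ?_ bot_le)
  have h := lintegral_exp_neg_pld_le P Q
  have : ∀ᵐ z ∂(pld P Q), EReal.exp (-z) < ∞ :=
    ae_lt_top measurable_exp_neg (ne_top_of_le_ne_top (measure_ne_top _ _) h)
  rw [ae_iff] at this
  rw [← this]
  refine measure_mono fun z hz => ?_
  simp only [Set.mem_ofPred_eq, not_not] at hz ⊢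
  simp [hz]

variable {P Q} in
lemma risk_pld_le_test (γ : ℝ≥0∞) {A : Set Ω} (hA : MeasurableSet A) :
    risk (pld P Q) γ ≤ P Aᶜ + γ * Q A := by
  rw [risk_pld P Q γ, ← lintegral_add_compl _ hA, add_comm]
  have hP : P Aᶜ = ∫⁻ ω in Aᶜ, P.rnDeriv (P + Q) ω ∂(P + Q) := by
    conv_lhs => rw [← withDensity_rnDeriv_add_left P Q]
    exact withDensity_apply _ hA.compl
  have hQ : Q A = ∫⁻ ω in A, Q.rnDeriv (P + Q) ω ∂(P + Q) := by
    conv_lhs => rw [← withDensity_rnDeriv_add_right P Q]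
    exact withDensity_apply _ hA
  rw [hP, hQ, ← lintegral_const_mul _ (Measure.measurable_rnDeriv _ _)]
  gcongr with ω ω
  · exact min_le_left _ _
  · exact min_le_right _ _

/-- Neyman–Pearson: the likelihood ratio test picks the smaller of the two densities at every point.
-/
lemma exists_test_le_risk_pld (γ : ℝ≥0∞) :
    ∃ A, MeasurableSet A ∧ P Aᶜ + γ * Q A ≤ risk (pld P Q) γ := by
  let A : Set Ω := {ω | γ * Q.rnDeriv (P + Q) ω < P.rnDeriv (P + Q) ω}
  have hA : MeasurableSet A := measurableSet_lt
    ((Measure.measurable_rnDeriv _ _).const_mul _) (Measure.measurable_rnDeriv _ _)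
  refine ⟨A, hA, ?_⟩
  rw [risk_pld P Q γ, ← lintegral_add_compl _ hA, add_comm]
  have hP : P Aᶜ = ∫⁻ ω in Aᶜ, P.rnDeriv (P + Q) ω ∂(P + Q) := by
    conv_lhs => rw [← withDensity_rnDeriv_add_left P Q]
    exact withDensity_apply _ hA.compl
  have hQ : Q A = ∫⁻ ω in A, Q.rnDeriv (P + Q) ω ∂(P + Q) := by
    conv_lhs => rw [← withDensity_rnDeriv_add_right P Q]
    exact withDensity_apply _ hA
  rw [hP, hQ, ← lintegral_const_mul _ (Measure.measurable_rnDeriv _ _)]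
  refine add_le_add (setLIntegral_mono' hA fun ω hω => ?_)
    (setLIntegral_mono' hA.compl fun ω hω => ?_)
  · exact le_min hω.le le_rfl
  · exact le_min le_rfl (not_lt.1 hω)

/-- The Bayes risk of randomized tests. -/
lemma risk_pld_le_randomized (γ : ℝ≥0∞) {a b : Ω → ℝ≥0∞} (ha : Measurable a)
    (hb : Measurable b) (hab : ∀ ω, a ω + b ω = 1) :
    risk (pld P Q) γ ≤ ∫⁻ ω, a ω ∂P + γ * ∫⁻ ω, b ω ∂Q := by
  rw [risk_pld P Q γ, lintegral_left P Q ha, lintegral_right P Q hb,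
    ← lintegral_const_mul _ ((Measure.measurable_rnDeriv _ _).fun_mul hb),
    ← lintegral_add_left ((Measure.measurable_rnDeriv _ _).fun_mul ha)]
  refine lintegral_mono fun ω => ?_
  calc _ = min (P.rnDeriv (P + Q) ω) (γ * Q.rnDeriv (P + Q) ω) * a ω
        + min (P.rnDeriv (P + Q) ω) (γ * Q.rnDeriv (P + Q) ω) * b ω := by
        rw [← mul_add, hab, mul_one]
    _ ≤ P.rnDeriv (P + Q) ω * a ω + γ * Q.rnDeriv (P + Q) ω * b ω := by
        gcongr
        · exact min_le_left _ _
        · exact min_le_right _ _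
    _ = _ := by simp only [mul_assoc]

end Risk

/-- Post-processing increases the Bayes risk. -/
lemma PairLE.risk_le {Ω Ω' : Type u} [MeasurableSpace Ω] [MeasurableSpace Ω']
    {P Q : Measure Ω} {P' Q' : Measure Ω'} [IsFiniteMeasure P] [IsFiniteMeasure Q]
    [IsFiniteMeasure P'] [IsFiniteMeasure Q'] (h : PairLE P Q P' Q') (γ : ℝ≥0∞) :
    risk (pld P' Q') γ ≤ risk (pld P Q) γ := by
  obtain ⟨φ, hφ, hP, hQ⟩ := h
  obtain ⟨A, hA, hle⟩ := exists_test_le_risk_pld P Q γ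
  refine le_trans ?_ hle
  have e1 : P Aᶜ = ∫⁻ ω, φ ω Aᶜ ∂P' := by
    rw [hP, Measure.bind_apply hA.compl φ.measurable.aemeasurable]
  have e2 : Q A = ∫⁻ ω, φ ω A ∂Q' := by
    rw [hQ, Measure.bind_apply hA φ.measurable.aemeasurable]
  rw [e1, e2]
  refine risk_pld_le_randomized P' Q' γ (φ.measurable_coe hA.compl) (φ.measurable_coe hA) ?_
  intro ω
  rw [add_comm, prob_add_prob_compl hA]

/-! ### Basic facts on PLDs -/

namespace IsPLD

variable {L L' : Measure EReal}

lemma isProbabilityMeasure (h : IsPLD L) : IsProbabilityMeasure L := by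
  obtain ⟨Ω, _, P, Q, _, _, rfl⟩ := h
  infer_instance

lemma lintegral_exp_neg_le (h : IsPLD L) : ∫⁻ z, EReal.exp (-z) ∂L ≤ 1 := by
  obtain ⟨Ω, _, P, Q, _, _, rfl⟩ := h
  simpa using lintegral_exp_neg_pld_le P Q

lemma ae_ne_bot (h : IsPLD L) : ∀ᵐ z ∂L, z ≠ ⊥ := by
  obtain ⟨Ω, _, P, Q, _, _, rfl⟩ := h
  exact pld_ae_ne_bot P Q

lemma risk_le_min (h : IsPLD L) (γ : ℝ≥0∞) : risk L γ ≤ min 1 γ :=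
  have := h.isProbabilityMeasure
  Privacy.risk_le_min L h.lintegral_exp_neg_le γ

/-- After the loss `z` of the first mechanism, the second one is tested with weight `γ exp (-z)`. -/
lemma risk_conv (h : IsPLD L) (h' : IsPLD L') (γ : ℝ≥0∞) :
    risk (L.conv L') γ = ∫⁻ z, risk L' (γ * EReal.exp (-z)) ∂L := by
  have := h'.isProbabilityMeasure
  have hm : Measurable fun z : EReal => min 1 (γ * EReal.exp (-z)) :=
    measurable_const.min (measurable_exp_neg.const_mul _)
  rw [risk, Measure.lintegral_conv hm]
  refine lintegral_congr_ae ?_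
  -- Inverting the product of exponentials fails only if `⊥` meets `⊤`, which has probability zero.
  filter_upwards [h.ae_ne_bot] with z hz
  refine lintegral_congr_ae ?_
  filter_upwards [h'.ae_ne_bot] with w hw
  rw [EReal.exp_neg, EReal.exp_add, ENNReal.mul_inv, ← EReal.exp_neg, ← EReal.exp_neg, mul_assoc]
  · exact Or.inl (by simpa using hz)
  · exact Or.inr (by simpa using hw)

lemma risk_conv_le (h : IsPLD L) (h' : IsPLD L') (γ : ℝ≥0∞) :
    risk (L.conv L') γ ≤ risk L γ := by
  rw [h.risk_conv h']
  exact lintegral_mono fun z => h'.risk_le_min _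

end IsPLD

lemma PLDLE.risk_le {L L' : Measure EReal} (h : PLDLE L L') (γ : ℝ≥0∞) :
    risk L' γ ≤ risk L γ := by
  obtain ⟨Ω, Ω', _, _, P, Q, P', Q', _, _, _, _, rfl, rfl, hle⟩ := h
  exact hle.risk_le γ

lemma PLDLE.isPLD_left {L L' : Measure EReal} (h : PLDLE L L') : IsPLD L := by
  obtain ⟨Ω, Ω', _, _, P, Q, P', Q', h1, h2, h3, h4, rfl, rfl, hle⟩ := h
  exact ⟨Ω, _, P, Q, h1, h2, rfl⟩

lemma PLDLE.isPLD_right {L L' : Measure EReal} (h : PLDLE L L') : IsPLD L' := by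
  obtain ⟨Ω, Ω', _, _, P, Q, P', Q', h1, h2, h3, h4, rfl, rfl, hle⟩ := h
  exact ⟨Ω', _, P', Q', h3, h4, rfl⟩

/-! ### Concave functions as mixtures of hinges -/

/-- A concave function on the line is, on the unit interval, an affine function plus a mixture of
the hinges `y ↦ min x y`. -/
lemma exists_hinge_mixture {g : ℝ → ℝ} (hg : ConcaveOn ℝ Set.univ g) :
    ∃ (τ : Measure I) (s t : ℝ), τ Set.univ = ENNReal.ofReal (s - t) ∧
      (∀ c, (∀ᶠ y in 𝓝 (-1), HasDerivAt g c y) → s = c) ∧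
      (∀ c, (∀ᶠ y in 𝓝 2, HasDerivAt g c y) → t = c) ∧
      ∀ y : I, g y = g 0 + y * t + ∫ x : I, min (x : ℝ) y ∂τ := by
  set f : ℝ → ℝ := -g with hf
  have hfc : ConvexOn ℝ Set.univ f := hg.neg
  set M : ℝ → ℝ := fun u => derivWithin f (Set.Ioi u) u with hM
  have hMmono : Monotone M := by
    have := hfc.monotoneOn_rightDeriv
    simpa [monotoneOn_univ] using this
  have hderiv : ∀ u, HasDerivWithinAt f (M u) (Set.Ioi u) u := fun u =>
    hfc.hasDerivWithinAt_rightDeriv_of_mem_interior (by simp)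
  have hMeq : ∀ u c, HasDerivAt g c u → M u = -c := fun u c h =>
    (h.neg.hasDerivWithinAt).derivWithin (uniqueDiffWithinAt_Ioi u)
  set F := hMmono.stieltjesFunction with hF
  have hFeq : ∀ u c, (∀ᶠ y in 𝓝 u, HasDerivAt g c y) → F u = -c := by
    intro u c h
    rw [hF, Monotone.stieltjesFunction_eq]
    refine rightLim_eq_of_tendsto ?_
    refine Filter.Tendsto.congr' ?_ tendsto_const_nhds
    filter_upwards [nhdsWithin_le_nhds h] with y hy
    exact (hMeq y c hy).symm
  have hFM : ∀ᵐ u, F u = M u := by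
    have hc : {u | ¬ContinuousAt M u}.Countable := hMmono.countable_not_continuousAt
    filter_upwards [hc.ae_notMem volume] with u hu
    simp only [not_not] at hu
    rw [hF, Monotone.stieltjesFunction_eq]
    exact rightLim_eq_of_tendsto (hu.tendsto.mono_left nhdsWithin_le_nhds)
  -- The slope drop over `(-1, 0]` becomes an atom at `0` and that over `(1, 2]` an atom at `1`. The
  -- margins on both sides make kinks at the endpoints count.
  let p : ℝ → I := Set.projIcc 0 1 zero_le_one
  have hp : Measurable p := continuous_projIcc.measurable
  set ρ := F.measure.restrict (Set.Ioc (-1) 2) with hρ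
  have hρu : ρ Set.univ = ENNReal.ofReal (-F (-1) - -F 2) := by
    rw [hρ, Measure.restrict_apply_univ, StieltjesFunction.measure_Ioc]
    congr 1; ring
  have hfin : IsFiniteMeasure ρ := ⟨by rw [hρu]; exact ENNReal.ofReal_lt_top⟩
  refine ⟨ρ.map p, -F (-1), -F 2,
    by rw [Measure.map_apply hp MeasurableSet.univ]; simpa using hρu,
    fun c hc => by rw [hFeq _ _ hc, neg_neg], fun c hc => by rw [hFeq _ _ hc, neg_neg],
    fun y => ?_⟩
  have hmeas : Measurable fun x : I => min (x : ℝ) y := by fun_prop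
  rw [integral_map hp.aemeasurable hmeas.aestronglyMeasurable]
  have hint : Integrable (fun x : ℝ => min (p x : ℝ) y) ρ := by
    refine Integrable.of_bound (hmeas.comp hp).aestronglyMeasurable 1 (ae_of_all _ fun x => ?_)
    rw [Real.norm_eq_abs, abs_of_nonneg (le_min (p x).2.1 y.2.1)]
    exact (min_le_left _ _).trans (p x).2.2
  -- Layer cake: the integral of the hinge is that of the tails of `ρ`, and these are increments of
  -- `F`.
  rw [hint.integral_eq_integral_meas_lt (ae_of_all _ fun x => le_min (p x).2.1 y.2.1)]
  have hset : ∀ u ∈ Set.Ioi (0 : ℝ), ρ.real {x | u < min (p x : ℝ) y}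
      = (Set.Iio (y : ℝ)).indicator (fun u => F 2 - F u) u := by
    intro u hu
    rw [Set.mem_Ioi] at hu
    by_cases huy : u < y
    · rw [Set.indicator_of_mem (by exact huy)]
      have hu1 : u < 1 := huy.trans_le y.2.2
      have : {x | u < min (p x : ℝ) y} = Set.Ioi u := by
        ext x
        simp only [Set.mem_ofPred_eq, lt_min_iff, huy, and_true, Set.mem_Ioi, p,
          Set.coe_projIcc]
        simp [hu.not_gt, hu1]
      rw [this, Measure.real, hρ, Measure.restrict_apply measurableSet_Ioi]
      have h2 : Set.Ioi u ∩ Set.Ioc (-1) 2 = Set.Ioc u 2 := by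
        ext x
        simp only [Set.mem_inter_iff, Set.mem_Ioi, Set.mem_Ioc]
        constructor
        · rintro ⟨a, b, c⟩; exact ⟨a, c⟩
        · rintro ⟨a, b⟩; exact ⟨a, by linarith, b⟩
      rw [h2, StieltjesFunction.measure_Ioc, ENNReal.toReal_ofReal]
      linarith [F.mono (show u ≤ 2 by linarith)]
    · rw [Set.indicator_of_notMem (by exact huy)]
      have : {x | u < min (p x : ℝ) y} = ∅ := by
        ext x; simp [huy]
      rw [this, measureReal_empty]
  rw [setIntegral_congr_fun measurableSet_Ioi hset, setIntegral_indicator measurableSet_Iio,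
    Set.Ioi_inter_Iio, ← integral_Ioc_eq_integral_Ioo, ← intervalIntegral.integral_of_le y.2.1]
  have hMi : IntervalIntegrable M volume 0 y := hMmono.intervalIntegrable
  have e1 : ∫ u in (0 : ℝ)..y, (F 2 - F u) = ∫ u in (0 : ℝ)..y, (F 2 - M u) := by
    refine intervalIntegral.integral_congr_ae ?_
    filter_upwards [hFM] with u hu _
    rw [hu]
  have hcont : Continuous f := by
    have := hfc.continuousOn isOpen_univ
    rwa [continuousOn_univ] at this
  have e2 : ∫ u in (0 : ℝ)..y, M u = f y - f 0 :=
    intervalIntegral.integral_eq_sub_of_hasDeriv_right_of_le y.2.1 hcont.continuousOn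
      (fun u _ => hderiv u) hMi
  rw [e1, intervalIntegral.integral_sub intervalIntegrable_const hMi, e2,
    intervalIntegral.integral_const]
  simp [hf]
  ring

/-! ### Canonical pairs on the unit interval -/

section WithDensity

variable {Ω : Type u} [MeasurableSpace Ω] {μ : Measure Ω} {f g : Ω → ℝ≥0∞}

lemma withDensity_eq_withDensity_div (hf : Measurable f) (hg : Measurable g)
    (hfg : ∀ᵐ ω ∂μ, f ω + g ω < ∞) :
    μ.withDensity f = (μ.withDensity (f + g)).withDensity fun ω => f ω / (f ω + g ω) := by
  rw [← withDensity_mul _ (hf.add hg) (by fun_prop)]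
  refine withDensity_congr_ae ?_
  filter_upwards [hfg] with ω h
  rcases eq_or_ne (f ω + g ω) 0 with h0 | h0
  · simp [(add_eq_zero.1 h0).1, (add_eq_zero.1 h0).2]
  · exact (ENNReal.mul_div_cancel h0 h.ne).symm

/-- Any dominating measure computes the PLD: the densities with respect to `P + Q` are `f / (f + g)`
and `g / (f + g)`, and the common denominator cancels where `P` lives. -/
lemma pld_withDensity (hf : Measurable f) (hg : Measurable g)
    [IsFiniteMeasure (μ.withDensity f)] [IsFiniteMeasure (μ.withDensity g)]
    (hfg : ∀ᵐ ω ∂μ, f ω + g ω < ∞) :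
    pld (μ.withDensity f) (μ.withDensity g)
      = (μ.withDensity f).map fun ω => ENNReal.log (f ω / g ω) := by
  refine Measure.map_congr ?_
  have hsum : μ.withDensity f + μ.withDensity g = μ.withDensity (f + g) :=
    (withDensity_add_left hf g).symm
  have hfin : IsFiniteMeasure (μ.withDensity (f + g)) := hsum ▸ inferInstance
  have h1 := Measure.rnDeriv_withDensity (μ.withDensity (f + g)) (hf.div (hf.add hg))
  have h2 := Measure.rnDeriv_withDensity (μ.withDensity (f + g)) (hg.div (hg.add hf))
  have e1 := withDensity_eq_withDensity_div hf hg hfg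
  have e2 := withDensity_eq_withDensity_div hg hf (hfg.mono fun ω h => by rwa [add_comm])
  rw [add_comm g f] at e2
  have h1' : (μ.withDensity f).rnDeriv (μ.withDensity f + μ.withDensity g)
      =ᵐ[μ.withDensity (f + g)] fun ω => f ω / (f ω + g ω) := by
    rw [hsum]; nth_rewrite 1 [e1]; exact h1
  have h2' : (μ.withDensity g).rnDeriv (μ.withDensity f + μ.withDensity g)
      =ᵐ[μ.withDensity (f + g)] fun ω => g ω / (g ω + f ω) := by
    rw [hsum]; nth_rewrite 1 [e2]; exact h2
  rw [Filter.EventuallyEq, ae_withDensity_iff (hf.add hg)] at h1' h2'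
  rw [Filter.EventuallyEq, ae_withDensity_iff hf]
  filter_upwards [h1', h2', hfg] with ω a b h h0
  have hs : f ω + g ω ≠ 0 := fun hc => h0 (add_eq_zero.1 hc).1
  rw [privacyLoss, a hs, b hs, add_comm (g ω)]
  congr 1
  rw [div_eq_mul_inv, div_eq_mul_inv (g ω), div_eq_mul_inv, div_eq_mul_inv,
    ENNReal.mul_inv (Or.inr (ENNReal.inv_ne_top.2 hs)) (Or.inr (ENNReal.inv_ne_zero.2 h.ne)),
    inv_inv, mul_mul_mul_comm, ENNReal.inv_mul_cancel hs h.ne, mul_one]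

end WithDensity

/-- The distribution with density `x` with respect to `ν`. -/
def fstM (ν : Measure I) : Measure I := ν.withDensity fun x => ENNReal.ofReal x

/-- The distribution with density `1 - x` with respect to `ν`. -/
def sndM (ν : Measure I) : Measure I := ν.withDensity fun x => ENNReal.ofReal (1 - x)

/-- `ν` is the law under `P + Q` of the density of `P` with respect to `P + Q`, for some pair of
distributions `P` and `Q`. -/
structure IsPosterior (ν : Measure I) : Prop where
  fst : IsProbabilityMeasure (fstM ν)
  snd : IsProbabilityMeasure (sndM ν)

/-- The PLD of the canonical pair. -/
def canonPLD (ν : Measure I) : Measure EReal := pld (fstM ν) (sndM ν)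

lemma measurable_ofReal_coe : Measurable fun x : I => ENNReal.ofReal (x : ℝ) := by fun_prop

lemma measurable_ofReal_one_sub : Measurable fun x : I => ENNReal.ofReal (1 - (x : ℝ)) := by
  fun_prop

lemma measurable_log_odds : Measurable fun x : I =>
    ENNReal.log (ENNReal.ofReal (x : ℝ) / ENNReal.ofReal (1 - (x : ℝ))) :=
  (measurable_ofReal_coe.div measurable_ofReal_one_sub).ennreal_log

lemma ofReal_add_ofReal_one_sub (x : I) :
    ENNReal.ofReal (x : ℝ) + ENNReal.ofReal (1 - (x : ℝ)) = 1 := by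
  rw [← ENNReal.ofReal_add x.2.1 (sub_nonneg.2 x.2.2)]
  simp

lemma fstM_add_sndM (ν : Measure I) : fstM ν + sndM ν = ν := by
  rw [fstM, sndM, ← withDensity_add_left measurable_ofReal_coe]
  have : ((fun x : I => ENNReal.ofReal (x : ℝ)) + fun x : I => ENNReal.ofReal (1 - (x : ℝ))) = 1 :=
    funext ofReal_add_ofReal_one_sub
  rw [this, withDensity_one]

namespace IsPosterior

variable {ν : Measure I} (h : IsPosterior ν)
include h

lemma measure_univ : ν Set.univ = 2 := by
  have := h.fst
  have := h.snd
  rw [← fstM_add_sndM ν, Measure.add_apply, MeasureTheory.measure_univ, MeasureTheory.measure_univ]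
  norm_num

lemma isFiniteMeasure : IsFiniteMeasure ν := ⟨by rw [h.measure_univ]; simp⟩

lemma isPLD : IsPLD (canonPLD ν) := ⟨I, inferInstance, fstM ν, sndM ν, h.fst, h.snd, rfl⟩

lemma rnDeriv_fst :
    (fstM ν).rnDeriv (fstM ν + sndM ν) =ᵐ[ν] fun x => ENNReal.ofReal (x : ℝ) := by
  have := h.isFiniteMeasure
  rw [fstM_add_sndM]
  exact Measure.rnDeriv_withDensity ν measurable_ofReal_coe

lemma rnDeriv_snd :
    (sndM ν).rnDeriv (fstM ν + sndM ν) =ᵐ[ν] fun x => ENNReal.ofReal (1 - (x : ℝ)) := by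
  have := h.isFiniteMeasure
  rw [fstM_add_sndM]
  exact Measure.rnDeriv_withDensity ν measurable_ofReal_one_sub

lemma risk_canonPLD (γ : ℝ≥0∞) :
    risk (canonPLD ν) γ
      = ∫⁻ x : I, min (ENNReal.ofReal (x : ℝ)) (γ * ENNReal.ofReal (1 - (x : ℝ))) ∂ν := by
  have := h.fst
  have := h.snd
  rw [canonPLD, risk_pld, fstM_add_sndM]
  refine lintegral_congr_ae ?_
  have h1 := h.rnDeriv_fst
  have h2 := h.rnDeriv_snd
  rw [fstM_add_sndM] at h1 h2
  filter_upwards [h1, h2] with x a b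
  rw [a, b]

lemma canonPLD_eq_map :
    canonPLD ν = (fstM ν).map
      fun x : I => ENNReal.log (ENNReal.ofReal (x : ℝ) / ENNReal.ofReal (1 - (x : ℝ))) :=
  have : IsFiniteMeasure (ν.withDensity fun x : I => ENNReal.ofReal (x : ℝ)) :=
    have := h.fst; inferInstanceAs (IsFiniteMeasure (fstM ν))
  have : IsFiniteMeasure (ν.withDensity fun x : I => ENNReal.ofReal (1 - (x : ℝ))) :=
    have := h.snd; inferInstanceAs (IsFiniteMeasure (sndM ν))
  pld_withDensity measurable_ofReal_coe measurable_ofReal_one_sub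
    (ae_of_all _ fun x => by rw [ofReal_add_ofReal_one_sub]; exact ENNReal.one_lt_top)

lemma integral_coe : ∫ x : I, (x : ℝ) ∂ν = 1 := by
  have := h.fst
  have h1 := MeasureTheory.measure_univ (μ := fstM ν)
  rw [fstM, withDensity_apply _ MeasurableSet.univ, Measure.restrict_univ] at h1
  rw [integral_eq_lintegral_of_nonneg_ae (ae_of_all _ fun x => x.2.1)
    (by fun_prop : Measurable fun x : I => (x : ℝ)).aestronglyMeasurable, h1]
  simp

end IsPosterior

/-- Every PLD, on whatever space, is the PLD of a canonical pair. -/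
lemma exists_posterior {Ω : Type u} [MeasurableSpace Ω] (P Q : Measure Ω)
    [IsProbabilityMeasure P] [IsProbabilityMeasure Q] :
    ∃ ν : Measure I, IsPosterior ν ∧ canonPLD ν = pld P Q := by
  set f := P.rnDeriv (P + Q) with hf
  set g := Q.rnDeriv (P + Q) with hg
  have hfm : Measurable f := Measure.measurable_rnDeriv _ _
  -- The density is at most one only almost everywhere, hence the projection.
  let post : Ω → I := fun ω => Set.projIcc 0 1 zero_le_one (f ω).toReal
  have hpost : Measurable post := continuous_projIcc.measurable.comp hfm.ennreal_toReal
  have hsum := rnDeriv_add_rnDeriv_eq_one P Q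
  have hcoe : ∀ᵐ ω ∂(P + Q), ENNReal.ofReal (post ω : ℝ) = f ω
      ∧ ENNReal.ofReal (1 - (post ω : ℝ)) = g ω := by
    filter_upwards [hsum] with ω h
    change f ω + g ω = 1 at h
    have hf1 : f ω ≤ 1 := h ▸ le_self_add
    have hft : f ω ≠ ∞ := ne_top_of_le_ne_top ENNReal.one_ne_top hf1
    have hp : (post ω : ℝ) = (f ω).toReal := by
      have h1 : (f ω).toReal ≤ 1 := by simpa using ENNReal.toReal_mono ENNReal.one_ne_top hf1
      simp [post, Set.coe_projIcc, h1]
    have e1 : ENNReal.ofReal (post ω : ℝ) = f ω := by rw [hp, ENNReal.ofReal_toReal hft]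
    refine ⟨e1, ?_⟩
    have h2 := ofReal_add_ofReal_one_sub (post ω)
    rw [e1, ← h] at h2
    exact (ENNReal.add_right_inj hft).1 h2
  set ν := (P + Q).map post with hν
  have e1 : fstM ν = P.map post := by
    ext s hs
    rw [fstM, withDensity_apply _ hs, hν, setLIntegral_map hs measurable_ofReal_coe hpost,
      Measure.map_apply hpost hs]
    conv_rhs => rw [← withDensity_rnDeriv_add_left P Q, withDensity_apply _ (hpost hs)]
    exact lintegral_congr_ae (ae_restrict_of_ae (hcoe.mono fun ω h => h.1))
  have e2 : sndM ν = Q.map post := by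
    ext s hs
    rw [sndM, withDensity_apply _ hs, hν, setLIntegral_map hs measurable_ofReal_one_sub hpost,
      Measure.map_apply hpost hs]
    conv_rhs => rw [← withDensity_rnDeriv_add_right P Q, withDensity_apply _ (hpost hs)]
    exact lintegral_congr_ae (ae_restrict_of_ae (hcoe.mono fun ω h => h.2))
  have hν' : IsPosterior ν :=
    ⟨by rw [e1]; exact Measure.isProbabilityMeasure_map hpost.aemeasurable,
     by rw [e2]; exact Measure.isProbabilityMeasure_map hpost.aemeasurable⟩
  refine ⟨ν, hν', ?_⟩
  rw [hν'.canonPLD_eq_map, e1, Measure.map_map measurable_log_odds hpost, pld]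
  refine Measure.map_congr ?_
  have hac : P ≪ P + Q := Measure.AbsolutelyContinuous.rfl.add_right _
  filter_upwards [hac.ae_le hcoe] with ω h
  rw [Function.comp_apply, h.1, h.2, privacyLoss]

lemma IsPLD.exists_posterior {L : Measure EReal} (h : IsPLD L) :
    ∃ ν : Measure I, IsPosterior ν ∧ canonPLD ν = L := by
  obtain ⟨Ω, _, P, Q, _, _, rfl⟩ := h
  exact Privacy.exists_posterior P Q

/-- `IsPLD` asks for a sample space in `Type`; the canonical pair supplies one for a pair in any
universe. -/
lemma isPLD_pld {Ω : Type u} [MeasurableSpace Ω] (P Q : Measure Ω)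
    [IsProbabilityMeasure P] [IsProbabilityMeasure Q] : IsPLD (pld P Q) := by
  obtain ⟨ν, hν, h⟩ := Privacy.exists_posterior P Q
  exact h ▸ hν.isPLD

lemma isPLD_idPLD : IsPLD idPLD := by
  have h := isPLD_pld (Measure.dirac ()) (Measure.dirac ())
  have hp : pld (Measure.dirac ()) (Measure.dirac ()) = idPLD := by
    have hL : ∀ᵐ ω ∂(Measure.dirac () + Measure.dirac ()),
        privacyLoss (Measure.dirac ()) (Measure.dirac ()) ω = 0 := by
      filter_upwards [rnDeriv_add_rnDeriv_eq_one (Measure.dirac ()) (Measure.dirac ())] with ω h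
      rw [privacyLoss, ENNReal.div_self, ENNReal.log_one]
      · rintro h0; simp [h0] at h
      · rintro h0; simp [h0] at h
    rw [pld, Measure.map_congr (g := fun _ => (0 : EReal))
      ((Measure.AbsolutelyContinuous.rfl.add_right _).ae_le hL)]
    rw [Measure.map_const]; simp [idPLD]
  rwa [hp] at h

/-- The convolution of PLDs is a PLD: that of the product of the pairs. -/
lemma IsPLD.conv {L L' : Measure EReal} (h : IsPLD L) (h' : IsPLD L') : IsPLD (L.conv L') := by
  obtain ⟨ν, hν, rfl⟩ := h.exists_posterior
  obtain ⟨ν', hν', rfl⟩ := h'.exists_posterior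
  have := hν.fst
  have := hν.snd
  have := hν'.fst
  have := hν'.snd
  have := hν.isFiniteMeasure
  have := hν'.isFiniteMeasure
  have hp : pld ((fstM ν).prod (fstM ν')) ((sndM ν).prod (sndM ν'))
      = (canonPLD ν).conv (canonPLD ν') := by
    have e1 : (fstM ν).prod (fstM ν') = (ν.prod ν').withDensity
        fun z => ENNReal.ofReal (z.1 : ℝ) * ENNReal.ofReal (z.2 : ℝ) :=
      prod_withDensity measurable_ofReal_coe measurable_ofReal_coe
    have e2 : (sndM ν).prod (sndM ν') = (ν.prod ν').withDensity
        fun z => ENNReal.ofReal (1 - (z.1 : ℝ)) * ENNReal.ofReal (1 - (z.2 : ℝ)) :=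
      prod_withDensity measurable_ofReal_one_sub measurable_ofReal_one_sub
    have i1 : IsFiniteMeasure ((ν.prod ν').withDensity
        fun z => ENNReal.ofReal (z.1 : ℝ) * ENNReal.ofReal (z.2 : ℝ)) := e1 ▸ inferInstance
    have i2 : IsFiniteMeasure ((ν.prod ν').withDensity
        fun z => ENNReal.ofReal (1 - (z.1 : ℝ)) * ENNReal.ofReal (1 - (z.2 : ℝ))) :=
      e2 ▸ inferInstance
    have hpl := pld_withDensity (μ := ν.prod ν')
      (f := fun z => ENNReal.ofReal (z.1 : ℝ) * ENNReal.ofReal (z.2 : ℝ))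
      (g := fun z => ENNReal.ofReal (1 - (z.1 : ℝ)) * ENNReal.ofReal (1 - (z.2 : ℝ)))
      (by fun_prop) (by fun_prop) (ae_of_all _ fun z => by finiteness)
    have hm := measurable_log_odds
    rw [← e1, ← e2] at hpl
    rw [hpl, Measure.conv, hν.canonPLD_eq_map, hν'.canonPLD_eq_map,
      Measure.map_prod_map (fstM ν) (fstM ν') hm hm, Measure.map_map measurable_add (hm.prodMap hm)]
    refine Measure.map_congr (ae_of_all _ fun z => ?_)
    -- Additivity of the logarithm needs no side condition: `0 * ∞ = 0` matches `⊥ + ⊤ = ⊥`.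
    rw [Function.comp_apply, Prod.map, ← ENNReal.log_mul_add]
    simp only [div_eq_mul_inv]
    rw [ENNReal.mul_inv (Or.inr ENNReal.ofReal_ne_top) (Or.inl ENNReal.ofReal_ne_top),
      mul_mul_mul_comm]
  exact hp ▸ isPLD_pld _ _

/-! ### Hinge integrals -/

/-- The mixture of hinges `c ↦ ∫ min x c dν(x)`. -/
def hinge (ν : Measure I) (c : ℝ) : ℝ := ∫ x : I, min (x : ℝ) c ∂ν

lemma integrable_min (ν : Measure I) [IsFiniteMeasure ν] (c : ℝ) :
    Integrable (fun x : I => min (x : ℝ) c) ν :=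
  (by fun_prop : Continuous fun x : I => min (x : ℝ) c).integrable_of_hasCompactSupport
    (HasCompactSupport.of_compactSpace _)

lemma integrable_coe (ν : Measure I) [IsFiniteMeasure ν] : Integrable (fun x : I => (x : ℝ)) ν :=
  (by fun_prop : Continuous fun x : I => (x : ℝ)).integrable_of_hasCompactSupport
    (HasCompactSupport.of_compactSpace _)

namespace IsPosterior

variable {ν : Measure I} (h : IsPosterior ν)
include h

lemma hinge_of_one_le {c : ℝ} (hc : 1 ≤ c) : hinge ν c = 1 := by
  rw [hinge, ← h.integral_coe]
  exact integral_congr_ae (ae_of_all _ fun x => min_eq_left (x.2.2.trans hc))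

lemma hinge_of_nonpos {c : ℝ} (hc : c ≤ 0) : hinge ν c = 2 * c := by
  rw [hinge, integral_congr_ae (ae_of_all _ fun x : I => min_eq_right (hc.trans x.2.1)),
    integral_const, Measure.real, h.measure_univ]
  simp

/-- At `γ = c / (1 - c)` the integrand `min x (γ (1 - x))` equals `(min x c - c x) / (1 - c)`, and
`x` has integral one. -/
lemma risk_eq_hinge {c : ℝ} (hc0 : 0 ≤ c) (hc1 : c < 1) :
    risk (canonPLD ν) (ENNReal.ofReal (c / (1 - c)))
      = ENNReal.ofReal ((hinge ν c - c) / (1 - c)) := by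
  have := h.isFiniteMeasure
  have h1c : 0 < 1 - c := by linarith
  have e : ∀ x : I, min (ENNReal.ofReal (x : ℝ))
      (ENNReal.ofReal (c / (1 - c)) * ENNReal.ofReal (1 - (x : ℝ)))
      = ENNReal.ofReal ((min (x : ℝ) c - c * x) / (1 - c)) := by
    intro x
    rw [← ENNReal.ofReal_mul (by positivity), ← ENNReal.ofReal_min]
    congr 1
    rw [eq_div_iff h1c.ne', min_mul_of_nonneg _ _ h1c.le, ← min_sub_sub_right]
    congr 1
    · ring
    · field_simp
  have hint : Integrable (fun x : I => (min (x : ℝ) c - c * x) / (1 - c)) ν :=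
    ((integrable_min ν c).sub ((integrable_coe ν).const_mul c)).div_const _
  rw [h.risk_canonPLD, lintegral_congr e, ← ofReal_integral_eq_lintegral_ofReal hint]
  · rw [integral_div, integral_sub (integrable_min ν c) ((integrable_coe ν).const_mul c),
      integral_const_mul, h.integral_coe, mul_one]
    rfl
  · refine ae_of_all _ fun x => div_nonneg (sub_nonneg.2 (le_min ?_ ?_)) h1c.le
    · nlinarith [x.2.1]
    · nlinarith [x.2.2]

lemma le_hinge {c : ℝ} (hc0 : 0 ≤ c) (hc1 : c ≤ 1) : c ≤ hinge ν c := by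
  have := h.isFiniteMeasure
  calc c = ∫ x : I, c * x ∂ν := by rw [integral_const_mul, h.integral_coe, mul_one]
    _ ≤ hinge ν c := integral_mono ((integrable_coe ν).const_mul c) (integrable_min ν c) fun x =>
        le_min (by nlinarith [x.2.1]) (by nlinarith [x.2.2])

end IsPosterior

/-- For `c` outside `[0, 1)` all posteriors have the same hinge integral; inside, `c / (1 - c)` runs
through all finite weights. -/
lemma hinge_le_hinge_of_risk_le {ν ν' : Measure I} (h : IsPosterior ν) (h' : IsPosterior ν')
    (hr : ∀ γ, γ ≠ ∞ → risk (canonPLD ν') γ ≤ risk (canonPLD ν) γ) (c : ℝ) :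
    hinge ν' c ≤ hinge ν c := by
  rcases le_total c 0 with h0 | h0
  · rw [h.hinge_of_nonpos h0, h'.hinge_of_nonpos h0]
  rcases le_or_gt 1 c with h1 | h1
  · rw [h.hinge_of_one_le h1, h'.hinge_of_one_le h1]
  have h1c : 0 < 1 - c := by linarith
  have := hr (ENNReal.ofReal (c / (1 - c))) ENNReal.ofReal_ne_top
  rw [h.risk_eq_hinge h0 h1, h'.risk_eq_hinge h0 h1, ENNReal.ofReal_le_ofReal_iff
    (div_nonneg (sub_nonneg.2 (h.le_hinge h0 h1.le)) h1c.le), div_le_div_iff_of_pos_right h1c] at this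
  linarith

/-! ### Blackwell's theorem for pairs -/

/-- An inequality between hinge integrals extends to all concave functions. -/
lemma integral_concave_le {ν ν' : Measure I} (h : IsPosterior ν) (h' : IsPosterior ν')
    (hle : ∀ c, hinge ν' c ≤ hinge ν c) {K : ℝ → ℝ} (hK : ConcaveOn ℝ Set.univ K) :
    ∫ x : I, K x ∂ν' ≤ ∫ x : I, K x ∂ν := by
  have := h.isFiniteMeasure
  have := h'.isFiniteMeasure
  obtain ⟨τ, s, t, hτ, -, -, hKτ⟩ := exists_hinge_mixture hK
  have : IsFiniteMeasure τ := ⟨by rw [hτ]; exact ENNReal.ofReal_lt_top⟩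
  -- Mass `2` and mean `1` are common to all posteriors, so only the last term, obtained by Fubini,
  -- distinguishes them.
  have key : ∀ ρ : Measure I, IsPosterior ρ →
      ∫ y : I, K y ∂ρ = 2 * K 0 + t + ∫ x : I, hinge ρ x ∂τ := by
    intro ρ hρ
    have := hρ.isFiniteMeasure
    have hint : Integrable (Function.uncurry fun y x : I => min (x : ℝ) (y : ℝ)) (ρ.prod τ) :=
      (by simp only [Function.uncurry_def]; fun_prop :
        Continuous (Function.uncurry fun y x : I => min (x : ℝ) (y : ℝ))).integrable_of_hasCompactSupport
        (HasCompactSupport.of_compactSpace _)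
    have hi1 : Integrable (fun y : I => K 0 + (y : ℝ) * t) ρ :=
      (integrable_const _).add ((integrable_coe ρ).mul_const t)
    have hi2 : Integrable (fun y : I => ∫ x : I, min (x : ℝ) (y : ℝ) ∂τ) ρ := hint.integral_prod_left
    rw [integral_congr_ae (ae_of_all _ hKτ), integral_add hi1 hi2,
      integral_add (integrable_const _) ((integrable_coe ρ).mul_const t), integral_const,
      integral_mul_const, hρ.integral_coe, one_mul, integral_integral_swap hint]
    congr 1
    · simp [Measure.real, hρ.measure_univ]
    · refine integral_congr_ae (ae_of_all _ fun x => ?_)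
      exact integral_congr_ae (ae_of_all _ fun y => min_comm _ _)
  have hh : ∀ ρ : Measure I, IsPosterior ρ → Integrable (fun x : I => hinge ρ x) τ := by
    intro ρ hρ
    have := hρ.isFiniteMeasure
    have hint : Integrable (Function.uncurry fun x y : I => min (y : ℝ) (x : ℝ)) (τ.prod ρ) :=
      (by simp only [Function.uncurry_def]; fun_prop :
        Continuous (Function.uncurry fun x y : I => min (y : ℝ) (x : ℝ))).integrable_of_hasCompactSupport
        (HasCompactSupport.of_compactSpace _)
    exact hint.integral_prod_left
  rw [key ν h, key ν' h']
  refine add_le_add_right ?_ _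
  exact integral_mono (hh ν' h') (hh ν h) fun x => hle x

/-- The infimum over `x` of the affine functions on the right is a concave function of `y` lying
between `k` and `u`. This is the domination required by Hahn–Banach. -/
lemma integral_le_of_le_affine {ν ν' : Measure I} (h : IsPosterior ν) (h' : IsPosterior ν')
    (hle : ∀ c, hinge ν' c ≤ hinge ν c) {k u s : C(I, ℝ)}
    (hk : ∀ x y : I, k y ≤ u x + s x * ((y : ℝ) - x)) : ∫ y, k y ∂ν' ≤ ∫ x, u x ∂ν := by
  have := h.isFiniteMeasure
  have := h'.isFiniteMeasure
  set K : ℝ → ℝ := fun y => ⨅ x : I, (u x + s x * (y - x)) with hKdef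
  have hbdd : ∀ y : ℝ, BddBelow (Set.range fun x : I => u x + s x * (y - x)) := fun y =>
    (isCompact_range (by fun_prop)).bddBelow
  have hK : ConcaveOn ℝ Set.univ K := by
    refine ⟨convex_univ, fun y _ z _ a b ha hb hab => le_ciInf fun x => ?_⟩
    have h1 : K y ≤ u x + s x * (y - x) := ciInf_le (hbdd y) x
    have h2 : K z ≤ u x + s x * (z - x) := ciInf_le (hbdd z) x
    calc a • K y + b • K z ≤ a * (u x + s x * (y - x)) + b * (u x + s x * (z - x)) := by
          simp only [smul_eq_mul]; gcongr
      _ = (a + b) * (u x - s x * x) + s x * (a * y + b * z) := by ring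
      _ = u x + s x * (a • y + b • z - x) := by rw [hab]; simp only [smul_eq_mul]; ring
  have hKc : Continuous K := by
    have := hK.neg.continuousOn isOpen_univ
    rw [continuousOn_univ] at this
    simpa using this.neg
  have hKi : ∀ ρ : Measure I, IsFiniteMeasure ρ → Integrable (fun x : I => K x) ρ := fun ρ _ =>
    (hKc.comp continuous_subtype_val).integrable_of_hasCompactSupport
      (HasCompactSupport.of_compactSpace _)
  have hci : ∀ (ρ : Measure I), IsFiniteMeasure ρ → ∀ f : C(I, ℝ), Integrable f ρ := fun ρ _ f =>
    f.continuous.integrable_of_hasCompactSupport (HasCompactSupport.of_compactSpace _)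
  calc ∫ y, k y ∂ν' ≤ ∫ y : I, K y ∂ν' :=
        integral_mono (hci _ ‹_› _) (hKi _ ‹_›) fun y => le_ciInf fun x => hk x y
    _ ≤ ∫ y : I, K y ∂ν := integral_concave_le h h' hle hK
    _ ≤ ∫ x, u x ∂ν := integral_mono (hKi _ ‹_›) (hci _ ‹_› _) fun x =>
        (ciInf_le (hbdd x) x).trans (by simp)

/-- The costs of the affine majorants `u x + s x * (y - x)` of `f x y`. -/
def majorantCosts (ν : Measure I) (f : C(I × I, ℝ)) : Set ℝ :=
  {r | ∃ u s : C(I, ℝ), (∀ x y : I, f (x, y) ≤ u x + s x * ((y : ℝ) - x)) ∧ r = ∫ x, u x ∂ν}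

/-- Strassen's theorem: posteriors in the concave order are the marginals of a martingale. -/
lemma exists_martingale_coupling {ν ν' : Measure I} (h : IsPosterior ν) (h' : IsPosterior ν')
    (hle : ∀ c, hinge ν' c ≤ hinge ν c) :
    ∃ π : Measure (I × I), IsFiniteMeasure π ∧ π.map Prod.fst = ν ∧ π.map Prod.snd = ν' ∧
      ∀ s : C(I, ℝ), ∫ z, s z.1 * ((z.2 : ℝ) - z.1) ∂π = 0 := by
  have := h.isFiniteMeasure
  have := h'.isFiniteMeasure
  have hci : ∀ (ρ : Measure I), IsFiniteMeasure ρ → ∀ f : C(I, ℝ), Integrable f ρ := fun ρ _ f =>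
    f.continuous.integrable_of_hasCompactSupport (HasCompactSupport.of_compactSpace _)
  -- The sublinear functional dual to the coupling problem: a majorant is charged for `u`, whereas
  -- the martingale term with slope `s` is free.
  set N : C(I × I, ℝ) → ℝ := fun f => sInf (majorantCosts ν f) with hN
  have hne : ∀ f, (majorantCosts ν f).Nonempty := fun f =>
    ⟨_, ContinuousMap.const I ‖f‖, 0, fun x y => by
      simpa using (le_abs_self _).trans (f.norm_coe_le_norm (x, y)), rfl⟩
  have hbdd : ∀ f, BddBelow (majorantCosts ν f) := by
    intro f
    refine ⟨∫ x : I, f (x, x) ∂ν, ?_⟩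
    rintro r ⟨u, s, hus, rfl⟩
    exact integral_mono (hci ν ‹_› ⟨fun x => f (x, x), by fun_prop⟩) (hci ν ‹_› u) fun x => by
      simpa using hus x x
  have hN_le : ∀ f (u s : C(I, ℝ)), (∀ x y : I, f (x, y) ≤ u x + s x * ((y : ℝ) - x)) →
      N f ≤ ∫ x, u x ∂ν := fun f u s hus => csInf_le (hbdd f) ⟨u, s, hus, rfl⟩
  have hN_add : ∀ f g, N (f + g) ≤ N f + N g := by
    intro f g
    rw [← sub_le_iff_le_add]
    refine le_csInf (hne _) ?_
    rintro r ⟨u, s, hus, rfl⟩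
    rw [sub_le_comm]
    refine le_csInf (hne _) ?_
    rintro r ⟨u', s', hus', rfl⟩
    rw [sub_le_iff_le_add, ← integral_add (hci ν ‹_› u') (hci ν ‹_› u)]
    refine hN_le _ (u' + u) (s' + s) fun x y => ?_
    have := hus x y
    have := hus' x y
    simp only [ContinuousMap.add_apply]
    linarith
  have hN_smul_le : ∀ c : ℝ, 0 < c → ∀ f, N (c • f) ≤ c * N f := by
    intro c hc f
    rw [← div_le_iff₀' hc]
    refine le_csInf (hne f) ?_
    rintro r ⟨u, s, hus, rfl⟩
    rw [div_le_iff₀' hc, ← integral_const_mul]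
    refine hN_le _ (c • u) (c • s) fun x y => ?_
    have := mul_le_mul_of_nonneg_left (hus x y) hc.le
    simp only [ContinuousMap.smul_apply, smul_eq_mul]
    linarith
  have hN_smul : ∀ c : ℝ, 0 < c → ∀ f, N (c • f) = c * N f := by
    intro c hc f
    refine le_antisymm (hN_smul_le c hc f) ?_
    have := hN_smul_le c⁻¹ (inv_pos.2 hc) (c • f)
    rw [smul_smul, inv_mul_cancel₀ hc.ne', one_smul] at this
    rwa [← le_inv_mul_iff₀ hc]
  let S : C(I, ℝ) →ₗ[ℝ] C(I × I, ℝ) :=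
    { toFun := fun k => k.comp ContinuousMap.snd
      map_add' := fun _ _ => rfl
      map_smul' := fun _ _ => rfl }
  -- Only its values on functions of the second coordinate matter, so the first coordinate `0` is
  -- arbitrary.
  let Λ₀ : C(I × I, ℝ) →ₗ[ℝ] ℝ :=
    { toFun := fun f => ∫ y, f (0, y) ∂ν'
      map_add' := fun f g => integral_add (hci ν' ‹_› ⟨fun y => f (0, y), by fun_prop⟩)
        (hci ν' ‹_› ⟨fun y => g (0, y), by fun_prop⟩)
      map_smul' := fun c f => integral_const_mul c _ }
  -- The functional extended by Hahn–Banach already prescribes the second marginal; domination by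
  -- `N` will force positivity, the first marginal and the martingale property.
  obtain ⟨Λ, hΛ₀, hΛN⟩ := exists_extension_of_le_sublinear
    (⟨LinearMap.range S, Λ₀.domRestrict _⟩ : C(I × I, ℝ) →ₗ.[ℝ] ℝ) N hN_smul hN_add (by
      rintro ⟨_, k, rfl⟩
      refine le_csInf (hne _) ?_
      rintro r ⟨u, s, hus, rfl⟩
      exact integral_le_of_le_affine h h' hle (k := k) (fun x y => hus x y))
  have hΛk : ∀ k : C(I, ℝ), Λ (S k) = ∫ y, k y ∂ν' := fun k => hΛ₀ ⟨S k, k, rfl⟩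
  have hΛnonpos : ∀ f : C(I × I, ℝ), (∀ z, f z ≤ 0) → Λ f ≤ 0 := fun f hf =>
    (hΛN f).trans ((hN_le f 0 0 fun x y => by simpa using hf (x, y)).trans (by simp))
  let Λc : CompactlySupportedContinuousMap (I × I) ℝ →ₗ[ℝ] ℝ :=
    { toFun := fun f => Λ f.toContinuousMap
      map_add' := fun f g => Λ.map_add f.toContinuousMap g.toContinuousMap
      map_smul' := fun c f => Λ.map_smul c f.toContinuousMap }
  let Λp : CompactlySupportedContinuousMap (I × I) ℝ →ₚ[ℝ] ℝ :=
    PositiveLinearMap.mk₀ Λc fun f hf => by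
      have h1 := hΛnonpos (-f.toContinuousMap) fun z => neg_nonpos.2 (hf z)
      rw [map_neg] at h1
      exact neg_nonpos.1 h1
  set π := RealRMK.rieszMeasure Λp with hπ
  have hπf : IsFiniteMeasure π := ⟨IsCompact.measure_lt_top isCompact_univ⟩
  have hπi : ∀ f : C(I × I, ℝ), ∫ z, f z ∂π = Λ f := fun f =>
    RealRMK.integral_rieszMeasure Λp ⟨f, HasCompactSupport.of_compactSpace _⟩
  refine ⟨π, hπf, ?_, ?_, ?_⟩
  · refine ext_of_forall_integral_eq_of_IsFiniteMeasure fun f => ?_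
    rw [integral_map measurable_fst.aemeasurable f.continuous.aestronglyMeasurable]
    -- A function `u` of the first coordinate is its own majorant with slope zero; applying this to
    -- `-f` as well gives equality.
    have key : ∀ u : C(I, ℝ), ∫ z : I × I, u z.1 ∂π ≤ ∫ x, u x ∂ν := fun u =>
      (hπi (u.comp ContinuousMap.fst)).trans_le ((hΛN _).trans (hN_le _ u 0 fun x y => by simp))
    refine le_antisymm (key f.toContinuousMap) ?_
    have := key (-f.toContinuousMap)
    simp only [ContinuousMap.neg_apply, integral_neg, neg_le_neg_iff] at this
    exact this
  · refine ext_of_forall_integral_eq_of_IsFiniteMeasure fun f => ?_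
    rw [integral_map measurable_snd.aemeasurable f.continuous.aestronglyMeasurable]
    exact (hπi (S f.toContinuousMap)).trans (hΛk _)
  -- Here the majorant has `u = 0` and costs nothing; the sign of `s` is free.
  · have key : ∀ s : C(I, ℝ), ∫ z : I × I, s z.1 * ((z.2 : ℝ) - z.1) ∂π ≤ 0 := fun s =>
      (hπi ⟨fun z => s z.1 * ((z.2 : ℝ) - z.1), by fun_prop⟩).trans_le ((hΛN _).trans
        ((hN_le _ 0 s fun x y => by simp).trans (by simp)))
    intro s
    refine le_antisymm (key s) ?_
    have := key (-s)
    simp only [ContinuousMap.neg_apply, neg_mul, integral_neg, neg_nonpos] at this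
    exact this

/-- Blackwell's theorem for canonical pairs. -/
lemma pairLE_of_hinge_le {ν ν' : Measure I} (h : IsPosterior ν) (h' : IsPosterior ν')
    (hle : ∀ c, hinge ν' c ≤ hinge ν c) :
    PairLE (fstM ν) (sndM ν) (fstM ν') (sndM ν') := by
  have := h.isFiniteMeasure
  have := h'.isFiniteMeasure
  obtain ⟨π, hπ, h1, h2, hs⟩ := exists_martingale_coupling h h' hle
  have hci : ∀ f : C(I × I, ℝ), Integrable f π := fun f =>
    f.continuous.integrable_of_hasCompactSupport (HasCompactSupport.of_compactSpace _)
  have m1 : Measurable fun z : I × I => ENNReal.ofReal (z.1 : ℝ) := by fun_prop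
  have m2 : Measurable fun z : I × I => ENNReal.ofReal (z.2 : ℝ) := by fun_prop
  have hfinD : ∀ g : C(I × I, ℝ), IsFiniteMeasure (π.withDensity fun z => ENNReal.ofReal (g z)) :=
    fun g => isFiniteMeasure_withDensity_ofReal (hci g).2
  have hfin1 := hfinD ⟨fun z => (z.1 : ℝ), by fun_prop⟩
  have hfin2 := hfinD ⟨fun z => (z.2 : ℝ), by fun_prop⟩
  simp only [ContinuousMap.coe_mk] at hfin1 hfin2
  -- The martingale property: weighting by either coordinate gives the same law of the first one.
  have hmart : (π.withDensity fun z => ENNReal.ofReal (z.2 : ℝ)).map Prod.fst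
      = (π.withDensity fun z => ENNReal.ofReal (z.1 : ℝ)).map Prod.fst := by
    refine ext_of_forall_integral_eq_of_IsFiniteMeasure fun f => ?_
    rw [integral_map measurable_fst.aemeasurable f.continuous.aestronglyMeasurable,
      integral_map measurable_fst.aemeasurable f.continuous.aestronglyMeasurable,
      integral_withDensity_eq_integral_toReal_smul m2 (ae_of_all _ fun _ => ENNReal.ofReal_lt_top),
      integral_withDensity_eq_integral_toReal_smul m1 (ae_of_all _ fun _ => ENNReal.ofReal_lt_top)]
    rw [← sub_eq_zero, ← integral_sub, ← hs f.toContinuousMap]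
    · refine integral_congr_ae (ae_of_all _ fun z => ?_)
      simp only [smul_eq_mul, ENNReal.toReal_ofReal z.1.2.1, ENNReal.toReal_ofReal z.2.2.1]
      change _ = f z.1 * _
      ring
    · refine (hci ⟨fun z => (z.2 : ℝ) * f z.1, by fun_prop⟩).congr (ae_of_all _ fun z => ?_)
      simp [ENNReal.toReal_ofReal z.2.2.1]
    · refine (hci ⟨fun z => (z.1 : ℝ) * f z.1, by fun_prop⟩).congr (ae_of_all _ fun z => ?_)
      simp [ENNReal.toReal_ofReal z.1.2.1]
  have hswap : ∀ A, MeasurableSet A → ∫⁻ z in Prod.fst ⁻¹' A, ENNReal.ofReal (z.2 : ℝ) ∂π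
      = ∫⁻ x in A, ENNReal.ofReal (x : ℝ) ∂ν := by
    intro A hA
    have := congrArg (fun m => m A) hmart
    simp only [Measure.map_apply measurable_fst hA,
      withDensity_apply _ (measurable_fst hA)] at this
    rw [this, ← h1, setLIntegral_map hA measurable_ofReal_coe measurable_fst]
  have hone : ∀ A, MeasurableSet A → ∫⁻ z in Prod.fst ⁻¹' A, ENNReal.ofReal (1 - (z.2 : ℝ)) ∂π
      = ∫⁻ x in A, ENNReal.ofReal (1 - (x : ℝ)) ∂ν := by
    intro A hA
    have e1 : ∫⁻ z in Prod.fst ⁻¹' A, ENNReal.ofReal (z.2 : ℝ) ∂π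
        + ∫⁻ z in Prod.fst ⁻¹' A, ENNReal.ofReal (1 - (z.2 : ℝ)) ∂π
        = ∫⁻ x in A, ENNReal.ofReal (x : ℝ) ∂ν + ∫⁻ x in A, ENNReal.ofReal (1 - (x : ℝ)) ∂ν := by
      rw [← lintegral_add_left m2, ← lintegral_add_left measurable_ofReal_coe]
      simp only [ofReal_add_ofReal_one_sub, lintegral_one, Measure.restrict_apply_univ]
      rw [← h1, Measure.map_apply measurable_fst hA]
    rw [hswap A hA] at e1
    refine (ENNReal.add_right_inj ?_).1 e1
    refine ne_top_of_le_ne_top (measure_ne_top ν Set.univ) ?_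
    calc ∫⁻ x in A, ENNReal.ofReal (x : ℝ) ∂ν ≤ ∫⁻ x, ENNReal.ofReal (x : ℝ) ∂ν :=
          setLIntegral_le_lintegral _ _
      _ ≤ ∫⁻ _, 1 ∂ν := lintegral_mono fun x => by simpa using x.2.2
      _ = ν Set.univ := by simp
  -- The kernel must run from `ν'` to `ν`, so the coupling is disintegrated over its second
  -- coordinate.
  set ρ := π.map Prod.swap with hρ
  have hρ1 : ρ.fst = ν' := by
    rw [Measure.fst, hρ, Measure.map_map measurable_fst measurable_swap]
    exact h2
  obtain ⟨φ, hφ, hdis⟩ : ∃ φ : Kernel I I, IsMarkovKernel φ ∧ ν' ⊗ₘ φ = ρ :=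
    ⟨ρ.condKernel, inferInstance, by rw [← hρ1]; exact ρ.disintegrate ρ.condKernel⟩
  have key : ∀ (w : I → ℝ≥0∞), Measurable w → ∀ A, MeasurableSet A →
      ((ν'.withDensity w).bind φ) A = ∫⁻ z in Prod.fst ⁻¹' A, w z.2 ∂π := by
    intro w hw A hA
    have hw' : Measurable fun z : I × I => w z.1 := hw.comp measurable_fst
    rw [Measure.bind_apply hA (Kernel.aemeasurable _),
      lintegral_withDensity_eq_lintegral_mul _ hw (Kernel.measurable_coe _ hA)]
    have e : ∫⁻ z in Prod.fst ⁻¹' A, w z.2 ∂π = ∫⁻ z in Prod.snd ⁻¹' A, w z.1 ∂ρ := by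
      rw [hρ, setLIntegral_map (measurable_snd hA) hw' measurable_swap]
      rfl
    rw [e, ← hdis, show (Prod.snd ⁻¹' A : Set (I × I)) = Set.univ ×ˢ A by ext; simp,
      Measure.setLIntegral_compProd hw' MeasurableSet.univ hA]
    simp [Pi.mul_apply]
  refine ⟨φ, hφ, ?_, ?_⟩
  · ext A hA
    rw [fstM, fstM, key _ measurable_ofReal_coe A hA, hswap A hA, withDensity_apply _ hA]
  · ext A hA
    rw [sndM, sndM, key _ measurable_ofReal_one_sub A hA, hone A hA, withDensity_apply _ hA]

/-- The Blackwell order on PLDs is the reverse of the pointwise order of Bayes risks. -/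
theorem pldLE_iff_risk_le {L L' : Measure EReal} (h : IsPLD L) (h' : IsPLD L') :
    PLDLE L L' ↔ ∀ γ, γ ≠ ∞ → risk L' γ ≤ risk L γ := by
  refine ⟨fun hle γ _ => hle.risk_le γ, fun hr => ?_⟩
  obtain ⟨ν, hν, rfl⟩ := h.exists_posterior
  obtain ⟨ν', hν', rfl⟩ := h'.exists_posterior
  exact ⟨I, I, inferInstance, inferInstance, fstM ν, sndM ν, fstM ν', sndM ν', hν.fst, hν.snd,
    hν'.fst, hν'.snd, rfl, rfl,
    pairLE_of_hinge_le hν hν' (hinge_le_hinge_of_risk_le hν hν' hr)⟩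

/-- The two hypotheses may represent `L'` by different pairs, so kernels cannot simply be composed;
risks can be compared. -/
lemma PLDLE.trans {L L' L'' : Measure EReal} (h : PLDLE L L') (h' : PLDLE L' L'') :
    PLDLE L L'' :=
  (pldLE_iff_risk_le h.isPLD_left h'.isPLD_right).2 fun γ _ => (h'.risk_le γ).trans (h.risk_le γ)

/-! ### Suprema of families of PLDs -/

lemma pldLE_of_hinge_le {ν ν' : Measure I} (h : IsPosterior ν) (h' : IsPosterior ν')
    (hle : ∀ c, hinge ν' c ≤ hinge ν c) : PLDLE (canonPLD ν) (canonPLD ν') :=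
  ⟨I, I, inferInstance, inferInstance, fstM ν, sndM ν, fstM ν', sndM ν', h.fst, h.snd,
    h'.fst, h'.snd, rfl, rfl, pairLE_of_hinge_le h h' hle⟩

lemma PLDLE.hinge_le {ν ν' : Measure I} (h : IsPosterior ν) (h' : IsPosterior ν')
    (hle : PLDLE (canonPLD ν) (canonPLD ν')) (c : ℝ) : hinge ν' c ≤ hinge ν c :=
  hinge_le_hinge_of_risk_le h h' (fun γ _ => hle.risk_le γ) c

lemma pldLE_idPLD {L : Measure EReal} (h : IsPLD L) : PLDLE idPLD L :=
  (pldLE_iff_risk_le isPLD_idPLD h).2 fun γ _ => (h.risk_le_min γ).trans (risk_idPLD γ).ge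

lemma isPosterior_of_integral {τ : Measure I} (h2 : τ Set.univ = 2)
    (h1 : ∫ x : I, (x : ℝ) ∂τ = 1) : IsPosterior τ := by
  have hfin : IsFiniteMeasure τ := ⟨by rw [h2]; simp⟩
  have hf : fstM τ Set.univ = 1 := by
    rw [fstM, withDensity_apply _ MeasurableSet.univ, Measure.restrict_univ,
      ← ofReal_integral_eq_lintegral_ofReal (integrable_coe τ) (ae_of_all _ fun x => x.2.1), h1,
      ENNReal.ofReal_one]
  refine ⟨⟨hf⟩, ⟨?_⟩⟩
  have h := congrArg (fun m => m Set.univ) (fstM_add_sndM τ)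
  simp only [Measure.add_apply, hf, h2, ← one_add_one_eq_two] at h
  exact (ENNReal.add_right_inj ENNReal.one_ne_top).1 h

lemma concaveOn_hinge (ν : Measure I) [IsFiniteMeasure ν] : ConcaveOn ℝ Set.univ (hinge ν) := by
  refine ⟨convex_univ, fun y _ z _ a b ha hb hab => ?_⟩
  simp only [hinge, smul_eq_mul]
  rw [← integral_const_mul, ← integral_const_mul, ← integral_add
    ((integrable_min ν y).const_mul a) ((integrable_min ν z).const_mul b)]
  refine integral_mono (((integrable_min ν y).const_mul a).add ((integrable_min ν z).const_mul b))
    (integrable_min ν _) fun x => le_min ?_ ?_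
  · calc a * min (x : ℝ) y + b * min (x : ℝ) z ≤ a * x + b * x := by
          gcongr <;> exact min_le_left _ _
      _ = x := by rw [← add_mul, hab, one_mul]
  · simp only
    gcongr <;> exact min_le_right _ _

/-- Every family of PLDs has a least upper bound `S`, and the Bayes risk of `S` is the infimum of
those of the members of the family and of `Id`. -/
lemma exists_isPLDSup {F : Set (Measure EReal)} (hF : ∀ L ∈ F, IsPLD L) :
    ∃ S, IsPLDSup F S ∧ ∀ γ, γ ≠ ∞ → ∀ ε, 0 < ε →
      ∃ L, (L ∈ F ∨ L = idPLD) ∧ risk L γ ≤ risk S γ + ENNReal.ofReal ε := by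
  -- Adjoining `Id`, the least PLD, keeps the upper bounds and makes the infimum meaningful for an
  -- empty family.
  let N : Set (Measure I) := {ν | IsPosterior ν ∧ (canonPLD ν ∈ F ∨ canonPLD ν = idPLD)}
  have hN : Nonempty N := by
    obtain ⟨ν, h, e⟩ := isPLD_idPLD.exists_posterior
    exact ⟨ν, h, Or.inr e⟩
  set g : ℝ → ℝ := fun c => ⨅ ν : N, hinge ν c with hg
  have hbdd : ∀ c, BddBelow (Set.range fun ν : N => hinge (ν : Measure I) c) := by
    intro c
    refine ⟨min (2 * c) 0, ?_⟩
    rintro _ ⟨⟨ν, hν, -⟩, rfl⟩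
    rcases le_total c 0 with h0 | h0
    · exact (min_le_left _ _).trans (hν.hinge_of_nonpos h0).ge
    · exact (min_le_right _ _).trans (integral_nonneg fun x => le_min x.2.1 h0)
  have hg_le : ∀ ν ∈ N, ∀ c, g c ≤ hinge ν c := fun ν hν c => ciInf_le (hbdd c) ⟨ν, hν⟩
  have hg_const : ∀ c a, (∀ ν, IsPosterior ν → hinge ν c = a) → g c = a := by
    intro c a h
    rw [hg]
    simp only
    rw [← ciInf_const (ι := N) (a := a)]
    exact iInf_congr fun ν => h ν ν.2.1
  have hg0 : ∀ c, c ≤ 0 → g c = 2 * c := fun c hc =>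
    hg_const c _ fun ν hν => hν.hinge_of_nonpos hc
  have hg1 : ∀ c, 1 ≤ c → g c = 1 := fun c hc =>
    hg_const c _ fun ν hν => hν.hinge_of_one_le hc
  have hconc : ConcaveOn ℝ Set.univ g := by
    refine ⟨convex_univ, fun y _ z _ a b ha hb hab => le_ciInf fun ν => ?_⟩
    have := ν.2.1.isFiniteMeasure
    refine le_trans ?_ ((concaveOn_hinge (ν : Measure I)).2 (Set.mem_univ y) (Set.mem_univ z)
      ha hb hab)
    simp only [smul_eq_mul]
    gcongr
    · exact hg_le ν ν.2 y
    · exact hg_le ν ν.2 z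
  obtain ⟨τ, s, t, hτ, hs, ht, hgτ⟩ := exists_hinge_mixture hconc
  -- The slopes `2` on the left and `0` on the right give the mixing measure its mass `2`; the value
  -- `1` at `c = 1` gives it mean one.
  have hs2 : s = 2 := by
    refine hs 2 ?_
    filter_upwards [Iio_mem_nhds (show (-1 : ℝ) < 0 by norm_num)] with y hy
    refine HasDerivAt.congr_of_eventuallyEq (f := fun c => 2 * c) ?_ ?_
    · simpa using (hasDerivAt_id y).const_mul 2
    · filter_upwards [Iio_mem_nhds hy] with c hc using hg0 c (le_of_lt hc)
  have ht0 : t = 0 := by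
    refine ht 0 ?_
    filter_upwards [Ioi_mem_nhds (show (1 : ℝ) < 2 by norm_num)] with y hy
    refine HasDerivAt.congr_of_eventuallyEq (hasDerivAt_const y 1) ?_
    filter_upwards [Ioi_mem_nhds hy] with c hc using hg1 c (le_of_lt hc)
  have hgI : ∀ y : I, g y = hinge τ y := fun y => by
    rw [hgτ, ht0, hg0 0 le_rfl]; simp [hinge]
  have hτ2 : τ Set.univ = 2 := by rw [hτ, hs2, ht0]; simp
  have hτp : IsPosterior τ := by
    refine isPosterior_of_integral hτ2 ?_
    have := hgI 1
    rw [Set.Icc.coe_one, hg1 1 le_rfl] at this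
    rw [this, hinge]
    exact integral_congr_ae (ae_of_all _ fun x => (min_eq_left x.2.2).symm)
  have hgh : ∀ c, hinge τ c = g c := by
    intro c
    rcases le_total c 0 with h0 | h0
    · rw [hτp.hinge_of_nonpos h0, hg0 c h0]
    rcases le_total 1 c with h1 | h1
    · rw [hτp.hinge_of_one_le h1, hg1 c h1]
    · exact (hgI ⟨c, h0, h1⟩).symm
  refine ⟨canonPLD τ, ⟨hτp.isPLD, fun L hL => ?_, fun U hU hub => ?_⟩, fun γ hγ ε hε => ?_⟩
  · obtain ⟨ν, hν, rfl⟩ := (hF L hL).exists_posterior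
    exact pldLE_of_hinge_le hν hτp fun c => (hgh c).trans_le (hg_le ν ⟨hν, Or.inl hL⟩ c)
  · obtain ⟨μ, hμ, rfl⟩ := hU.exists_posterior
    refine pldLE_of_hinge_le hτp hμ fun c => ?_
    rw [hgh]
    refine le_ciInf fun ν => ?_
    refine PLDLE.hinge_le ν.2.1 hμ ?_ c
    rcases ν.2.2 with h | h
    · exact hub _ h
    · rw [h]; exact pldLE_idPLD hU
  · set r := γ.toReal with hr
    have hr0 : 0 ≤ r := ENNReal.toReal_nonneg
    -- This inverts `γ = c / (1 - c)`.
    set c := r / (1 + r) with hc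
    have hc0 : 0 ≤ c := by positivity
    have h1c : 1 - c = 1 / (1 + r) := by rw [hc]; field_simp; ring
    have h1c0 : 0 < 1 - c := by rw [h1c]; positivity
    have hc1 : c < 1 := by linarith
    have hγc : γ = ENNReal.ofReal (c / (1 - c)) := by
      rw [h1c, hc, ← ENNReal.ofReal_toReal hγ, ← hr]
      congr 1
      field_simp
    -- Passing from hinge integrals to risks divides by `1 - c`, so the slack is `ε * (1 - c)`.
    obtain ⟨ν, hν⟩ := exists_lt_of_ciInf_lt
      (show (⨅ ν : N, hinge (ν : Measure I) c) < g c + ε * (1 - c) by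
        rw [hg]; simp only; linarith [mul_pos hε h1c0])
    refine ⟨canonPLD ν, ν.2.2, ?_⟩
    rw [hγc, ν.2.1.risk_eq_hinge hc0 hc1, hτp.risk_eq_hinge hc0 hc1,
      ← ENNReal.ofReal_add (div_nonneg (sub_nonneg.2 (hτp.le_hinge hc0 hc1.le)) h1c0.le) hε.le]
    refine ENNReal.ofReal_le_ofReal ?_
    rw [hgh, div_add' _ _ _ h1c0.ne', div_le_div_iff_of_pos_right h1c0]
    linarith

lemma isPLDSup_pldSup {F : Set (Measure EReal)} (hF : ∀ L ∈ F, IsPLD L) :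
    IsPLDSup F (pldSup F) := by
  obtain ⟨S, hS, -⟩ := exists_isPLDSup hF
  have h : ∃ S, IsPLDSup F S := ⟨S, hS⟩
  rw [pldSup, dif_pos h]
  exact h.choose_spec

lemma isPLD_pldSup (F : Set (Measure EReal)) : IsPLD (pldSup F) := by
  by_cases h : ∃ S, IsPLDSup F S
  · rw [pldSup, dif_pos h]
    exact h.choose_spec.1
  · rw [pldSup, dif_neg h]
    exact isPLD_idPLD

/-- The supremum picked by choice lies below the one constructed in `exists_isPLDSup`, so its risk
is at least as large and the approximation carries over. -/
lemma exists_risk_le_risk_pldSup_add {F : Set (Measure EReal)} (hF : ∀ L ∈ F, IsPLD L)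
    {γ : ℝ≥0∞} (hγ : γ ≠ ∞) {ε : ℝ} (hε : 0 < ε) :
    ∃ L, (L ∈ F ∨ L = idPLD) ∧ risk L γ ≤ risk (pldSup F) γ + ENNReal.ofReal ε := by
  obtain ⟨S, hS, h⟩ := exists_isPLDSup hF
  obtain ⟨L, hL, hle⟩ := h γ hγ ε hε
  refine ⟨L, hL, hle.trans ?_⟩
  gcongr
  exact ((isPLDSup_pldSup hF).2.2 S hS.1 hS.2.1).risk_le γ

/-! ### The value recursion -/

lemma isPLD_value (𝓛 : Set (Measure EReal)) (B : Measure EReal) :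
    ∀ n l, IsPLD (value 𝓛 B n l)
  | 0, _ => isPLD_idPLD
  | _ + 1, _ => isPLD_pldSup _

variable {𝓛 : Set (Measure EReal)} {B : Measure EReal}

lemma isPLD_of_mem_value_family (h𝓛 : ∀ L ∈ 𝓛, IsPLD L) (n : ℕ) (l : List (Measure EReal)) :
    ∀ R ∈ {R | ∃ L ∈ admissible 𝓛 B l, R = L.conv (value 𝓛 B n (l ++ [L]))}, IsPLD R := by
  rintro R ⟨L, hL, rfl⟩
  exact (h𝓛 L hL.1).conv (isPLD_value 𝓛 B n _)

lemma isPLDSup_value (h𝓛 : ∀ L ∈ 𝓛, IsPLD L) (n : ℕ) (l : List (Measure EReal)) :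
    IsPLDSup {R | ∃ L ∈ admissible 𝓛 B l, R = L.conv (value 𝓛 B n (l ++ [L]))}
      (value 𝓛 B (n + 1) l) :=
  isPLDSup_pldSup (isPLD_of_mem_value_family h𝓛 n l)

lemma convList_append_singleton (l : List (Measure EReal)) (L : Measure EReal) :
    convList (l ++ [L]) = (convList l).conv L := by
  simp [convList]

lemma isPLD_convList {l : List (Measure EReal)} (hl : ∀ L ∈ l, IsPLD L) : IsPLD (convList l) := by
  induction l using List.reverseRecOn with
  | nil => exact isPLD_idPLD
  | append_singleton l L ih =>
    rw [convList_append_singleton]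
    exact (ih fun L' h => hl L' (by simp [h])).conv (hl L (by simp))

lemma pldLE_conv_right {L L' : Measure EReal} (h : IsPLD L) (h' : IsPLD L') :
    PLDLE L (L.conv L') :=
  (pldLE_iff_risk_le h (h.conv h')).2 fun γ _ => h.risk_conv_le h' γ

/-! ### The interaction is dominated by the value -/

/-- Adaptive composition: if after every answer `ω` the tests `(a ω, b ω)` have at least the risk
of `V`, then on average they have at least the risk of `PLD(P ‖ Q) ⊕ V`. -/
lemma risk_conv_le_of_forall {Ω : Type u} [MeasurableSpace Ω] (P Q : Measure Ω)
    [IsProbabilityMeasure P] [IsProbabilityMeasure Q] {V : Measure EReal} (hV : IsPLD V)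
    {a b : Ω → ℝ≥0∞} (ha : Measurable a) (hb : Measurable b)
    (hab : ∀ ω γ, γ ≠ ∞ → risk V γ ≤ a ω + γ * b ω) {γ : ℝ≥0∞} (hγ : γ ≠ ∞) :
    risk ((pld P Q).conv V) γ ≤ ∫⁻ ω, a ω ∂P + γ * ∫⁻ ω, b ω ∂Q := by
  have hm : Measurable fun z : EReal => risk V (γ * EReal.exp (-z)) :=
    (measurable_risk V).comp (measurable_exp_neg.const_mul _)
  rw [(isPLD_pld P Q).risk_conv hV, lintegral_pld P Q hm]
  refine (lintegral_left P Q (hm.comp (measurable_privacyLoss P Q))).trans_le ?_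
  rw [lintegral_left P Q ha, lintegral_right P Q hb,
    ← lintegral_const_mul _ ((Measure.measurable_rnDeriv _ _).fun_mul hb),
    ← lintegral_add_left ((Measure.measurable_rnDeriv _ _).fun_mul ha)]
  refine lintegral_mono_ae ?_
  filter_upwards [exp_neg_privacyLoss P Q, rnDeriv_add_rnDeriv_eq_one P Q] with ω h1 h2
  rw [Function.comp_apply, h1]
  have hf : P.rnDeriv (P + Q) ω ≠ ∞ := ne_top_of_le_ne_top ENNReal.one_ne_top (h2 ▸ le_self_add)
  have hg : Q.rnDeriv (P + Q) ω ≠ ∞ := ne_top_of_le_ne_top ENNReal.one_ne_top (h2 ▸ le_add_self)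
  rcases eq_or_ne (P.rnDeriv (P + Q) ω) 0 with h0 | h0
  · simp [h0]
  -- The hypothesis is used at the updated weight `γ q / p`, where `p` and `q` are the densities at
  -- `ω`; this is why it is assumed at every finite weight.
  · calc P.rnDeriv (P + Q) ω * risk V (γ * (Q.rnDeriv (P + Q) ω / P.rnDeriv (P + Q) ω))
        ≤ P.rnDeriv (P + Q) ω *
          (a ω + γ * (Q.rnDeriv (P + Q) ω / P.rnDeriv (P + Q) ω) * b ω) := by
          gcongr
          exact hab ω _ (ENNReal.mul_ne_top hγ (ENNReal.div_ne_top hg h0))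
      _ = P.rnDeriv (P + Q) ω * a ω + γ * (Q.rnDeriv (P + Q) ω * b ω) := by
          rw [mul_add]
          congr 1
          calc _ = γ * (P.rnDeriv (P + Q) ω
                * (Q.rnDeriv (P + Q) ω / P.rnDeriv (P + Q) ω)) * b ω := by ring
            _ = _ := by rw [ENNReal.mul_div_cancel h0 hf]; ring

namespace Analyst

variable {𝓓 : Type v} {D₁ D₂ : 𝓓} {𝓛 : Set (Measure EReal)} (A : Analyst.{u, v} D₁ D₂ 𝓛)
  {B : Measure EReal} (hA : A.MeasurableDecisions B)

instance isMarkovKernel_response (D : 𝓓) (i : ℕ) : IsMarkovKernel (A.response B hA D i) := by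
  unfold response
  have : IsMarkovKernel ((A.query i D).map (Sum.inl : A.Y i → A.Y i ⊕ Unit)) :=
    Kernel.IsMarkovKernel.map _ measurable_inl
  infer_instance

instance isProbabilityMeasure_interaction (D : 𝓓) :
    ∀ k, IsProbabilityMeasure (A.interaction B hA D k)
  | 0 => inferInstanceAs (IsProbabilityMeasure (Measure.dirac (PUnit.unit : PUnit.{u + 1})))
  | k + 1 => by
    have := isProbabilityMeasure_interaction D k
    unfold interaction
    exact inferInstanceAs
      (IsProbabilityMeasure ((A.interaction B hA D k).compProd (A.response B hA D k)))

lemma lintegral_interaction_zero (D : 𝓓) {f : Transcript A.Y 0 → ℝ≥0∞} (hf : Measurable f) :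
    ∫⁻ y, f y ∂(A.interaction B hA D 0) = f PUnit.unit :=
  lintegral_dirac' (α := PUnit.{u + 1}) _ hf

lemma lintegral_interaction_succ (D : 𝓓) (k : ℕ) {f : Transcript A.Y (k + 1) → ℝ≥0∞}
    (hf : Measurable f) :
    ∫⁻ y, f y ∂(A.interaction B hA D (k + 1))
      = ∫⁻ y, ∫⁻ z, f (y, z) ∂(A.response B hA D k y) ∂(A.interaction B hA D k) :=
  Measure.lintegral_compProd (μ := A.interaction B hA D k) (κ := A.response B hA D k) hf

lemma measurable_lintegral_response (D : 𝓓) (k : ℕ) {f : Transcript A.Y (k + 1) → ℝ≥0∞}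
    (hf : Measurable f) : Measurable fun y => ∫⁻ z, f (y, z) ∂(A.response B hA D k y) :=
  Measurable.lintegral_kernel_prod_right' (κ := A.response B hA D k) hf

lemma measurable_transcript_mk (k : ℕ) (y : Transcript A.Y k) :
    Measurable fun z : A.Y k ⊕ Unit => ((y, z) : Transcript A.Y (k + 1)) :=
  measurable_prodMk_left

lemma lintegral_response_of_mem (D : 𝓓) (k : ℕ) {y : Transcript A.Y k} (hy : y ∈ A.answered B k)
    {f : A.Y k ⊕ Unit → ℝ≥0∞} (hf : Measurable f) :
    ∫⁻ z, f z ∂(A.response B hA D k y) = ∫⁻ w, f (Sum.inl w) ∂(A.query k D y) := by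
  classical
  rw [response, Kernel.piecewise_apply, if_pos hy, Kernel.map_apply _ measurable_inl,
    lintegral_map hf measurable_inl]

lemma lintegral_response_of_notMem (D : 𝓓) (k : ℕ) {y : Transcript A.Y k}
    (hy : y ∉ A.answered B k) {f : A.Y k ⊕ Unit → ℝ≥0∞} (hf : Measurable f) :
    ∫⁻ z, f z ∂(A.response B hA D k y) = f (Sum.inr ()) := by
  classical
  rw [response, Kernel.piecewise_apply, if_neg hy, Kernel.const_apply, lintegral_dirac' _ hf]

variable {A}

lemma mem_issued {i : ℕ} {y : Transcript A.Y i} {L : Measure EReal} (h : L ∈ A.issued i y) :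
    L ∈ 𝓛 := by
  induction i with
  | zero => simp [issued] at h
  | succ i ih =>
    simp only [issued, List.mem_append, List.mem_singleton] at h
    rcases h with h | rfl
    · exact ih h
    · exact A.query_mem i y.1

/-- The filter answers only if it has answered in all previous rounds. -/
lemma answered_of_answered_succ (h𝓛 : ∀ L ∈ 𝓛, IsPLD L) {i : ℕ} {y : Transcript A.Y (i + 1)}
    (h : y ∈ A.answered B (i + 1)) : y.1 ∈ A.answered B i := by
  refine ⟨h.1.1, PLDLE.trans ?_ h.2⟩
  have h2 : IsPLD (convList (A.issued i y.1 ++ [A.queryPLD i y.1])) :=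
    isPLD_convList fun L hL => h𝓛 L (mem_issued (i := i + 1) (y := y) hL)
  rw [convList_append_singleton (A.issued (i + 1) y)]
  exact pldLE_conv_right h2 (h𝓛 _ (A.query_mem (i + 1) y))

/-- Backward induction, where `a` and `b` stand for the error probabilities given the transcript of
`i` rounds. They are arbitrary so that the induction on `i` can replace them by their averages over
a round. The second hypothesis records that an analyst without an answer in round `i` does no better
than a test without data. -/
lemma risk_value_le (h𝓛 : ∀ L ∈ 𝓛, IsPLD L) (i : ℕ) :
    ∀ (n : ℕ) {a b : Transcript A.Y i → ℝ≥0∞}, Measurable a → Measurable b →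
      (∀ y γ, γ ≠ ∞ → risk (value 𝓛 B n (A.issued i y)) γ ≤ a y + γ * b y) →
      (∀ y ∉ A.answered B i, ∀ γ, γ ≠ ∞ → min 1 γ ≤ a y + γ * b y) →
      ∀ {γ : ℝ≥0∞}, γ ≠ ∞ → risk (value 𝓛 B (n + i) []) γ
        ≤ ∫⁻ y, a y ∂(A.interaction B hA D₁ i) + γ * ∫⁻ y, b y ∂(A.interaction B hA D₂ i) := by
  induction i with
  | zero =>
    intro n a b ha hb hab _ γ hγ
    rw [A.lintegral_interaction_zero hA D₁ ha, A.lintegral_interaction_zero hA D₂ hb]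
    exact hab _ _ hγ
  | succ i ih =>
    intro n a b ha hb hab hab' γ hγ
    rw [A.lintegral_interaction_succ hA D₁ i ha, A.lintegral_interaction_succ hA D₂ i hb,
      show n + (i + 1) = (n + 1) + i by ring]
    have hay : ∀ y, Measurable fun z => a (y, z) := fun y => ha.comp (A.measurable_transcript_mk i y)
    have hby : ∀ y, Measurable fun z => b (y, z) := fun y => hb.comp (A.measurable_transcript_mk i y)
    have hrefused : ∀ y ∉ A.answered B i, ∀ γ, γ ≠ ∞ → min 1 γ
        ≤ ∫⁻ z, a (y, z) ∂(A.response B hA D₁ i y)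
          + γ * ∫⁻ z, b (y, z) ∂(A.response B hA D₂ i y) := by
      intro y hy γ hγ
      rw [A.lintegral_response_of_notMem hA D₁ i hy (hay y),
        A.lintegral_response_of_notMem hA D₂ i hy (hby y)]
      -- Once an answer is withheld, the next one is withheld too, so the bound passes to the longer
      -- transcript.
      exact hab' _ (fun h => hy (answered_of_answered_succ h𝓛 h)) γ hγ
    refine ih (n + 1) (A.measurable_lintegral_response hA D₁ i ha)
      (A.measurable_lintegral_response hA D₂ i hb) (fun y γ hγ => ?_) hrefused hγ
    by_cases hy : y ∈ A.answered B i
    · rw [A.lintegral_response_of_mem hA D₁ i hy (hay y),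
        A.lintegral_response_of_mem hA D₂ i hy (hby y)]
      have hadm : A.queryPLD i y ∈ admissible 𝓛 B (A.issued i y) := by
        refine ⟨A.query_mem i y, ?_⟩
        rw [← convList_append_singleton]
        exact hy.2
      refine (((isPLDSup_value h𝓛 n (A.issued i y)).2.1 _ ⟨_, hadm, rfl⟩).risk_le γ).trans ?_
      exact risk_conv_le_of_forall _ _ (isPLD_value 𝓛 B n _) ((hay y).comp measurable_inl)
        ((hby y).comp measurable_inl) (fun w γ hγ => hab (y, Sum.inl w) γ hγ) hγ
    · exact ((isPLD_value 𝓛 B (n + 1) _).risk_le_min γ).trans (hrefused y hy γ hγ)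

/-- The PLD of the interaction is dominated by the value. -/
theorem pldLE_value (h𝓛 : ∀ L ∈ 𝓛, IsPLD L) (k : ℕ) :
    PLDLE (pld (A.interaction B hA D₁ k) (A.interaction B hA D₂ k)) (value 𝓛 B k []) := by
  refine (pldLE_iff_risk_le (isPLD_pld _ _) (isPLD_value 𝓛 B k [])).2 fun γ hγ => ?_
  obtain ⟨E, hE, hle⟩ :=
    exists_test_le_risk_pld (A.interaction B hA D₁ k) (A.interaction B hA D₂ k) γ
  refine le_trans ?_ hle
  rw [← lintegral_indicator_one hE, ← lintegral_indicator_one hE.compl]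
  have hleaf : ∀ y γ, γ ≠ ∞ → min 1 γ ≤ Eᶜ.indicator (1 : Transcript A.Y k → ℝ≥0∞) y + γ * E.indicator (1 : Transcript A.Y k → ℝ≥0∞) y := by
    intro y γ _
    by_cases hy : y ∈ E
    · simp [hy]
    · simp [hy]
  have := risk_value_le hA h𝓛 k 0 (measurable_one.indicator hE.compl) (measurable_one.indicator hE)
    (fun y γ hγ => (risk_idPLD γ).trans_le (hleaf y γ hγ)) (fun y _ γ hγ => hleaf y γ hγ) hγ
  rwa [zero_add] at this

end Analyst

/-! ### Near-optimal analysts -/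

/-- A strategy of an analyst that remembers each answer only up to a countable partition of the
space of answers: `post c` is the posterior of the query after the recorded cells `c`, and `cell c`
is the partition into which its answer is sorted. -/
structure Strategy (𝓛 : Set (Measure EReal)) where
  /-- the posterior of the query -/
  post : List ℕ → Measure I
  /-- the cell of the answer -/
  cell : List ℕ → I → ℕ
  isPosterior : ∀ c, IsPosterior (post c)
  mem : ∀ c, canonPLD (post c) ∈ 𝓛
  measurable_cell : ∀ c, Measurable (cell c)

namespace Strategy

variable {𝓛 : Set (Measure EReal)}

open Classical in
/-- The mean of `leaf` over the recorded cells, when the filter has budget `B`, `n` rounds are left,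
the cells `c` have been recorded after queries with the PLDs `l`, and the query with posterior `ν`
is answered according to `M ν`. -/
def mean (S : Strategy 𝓛) (B : Measure EReal) (M : Measure I → Measure I) (leaf : List ℕ → ℝ≥0∞) :
    ℕ → List ℕ → List (Measure EReal) → ℝ≥0∞
  | 0, c, _ => leaf c
  | n + 1, c, l =>
    if PLDLE ((convList l).conv (canonPLD (S.post c))) B then
      ∫⁻ x, S.mean B M leaf n (c ++ [S.cell c x]) (l ++ [canonPLD (S.post c)]) ∂(M (S.post c))
    else S.mean B M leaf n (c ++ [0]) (l ++ [canonPLD (S.post c)])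

/-- The strategy that issues the query with posterior `ν` and continues with `S m` if the answer
lies in the cell `m` of `d`. -/
def cons (ν : Measure I) (hν : IsPosterior ν) (hmem : canonPLD ν ∈ 𝓛) (d : I → ℕ)
    (hd : Measurable d) (S : ℕ → Strategy 𝓛) : Strategy 𝓛 where
  post := fun
    | [] => ν
    | m :: c => (S m).post c
  cell := fun
    | [] => d
    | m :: c => (S m).cell c
  isPosterior := by
    rintro (_ | ⟨m, c⟩)
    · exact hν
    · exact (S m).isPosterior c
  mem := by
    rintro (_ | ⟨m, c⟩)
    · exact hmem
    · exact (S m).mem c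
  measurable_cell := by
    rintro (_ | ⟨m, c⟩)
    · exact hd
    · exact (S m).measurable_cell c

variable {B : Measure EReal} {M : Measure I → Measure I}

/-- The first recorded cell selects the continuation, and the list of cells is then read by that
continuation alone. -/
lemma mean_cons {ν : Measure I} (hν : IsPosterior ν) (hmem : canonPLD ν ∈ 𝓛) {d : I → ℕ}
    (hd : Measurable d) (S : ℕ → Strategy 𝓛) {leaf : List ℕ → ℝ≥0∞} (m : ℕ) :
    ∀ n c l, (cons ν hν hmem d hd S).mean B M leaf n (m :: c) l
      = (S m).mean B M (fun c => leaf (m :: c)) n c l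
  | 0, _, _ => rfl
  | n + 1, c, l => by
    simp only [mean, List.cons_append, mean_cons hν hmem hd S m n]
    rfl

lemma mean_zero (S : Strategy 𝓛) : ∀ n c l, S.mean B M (fun _ => 0) n c l = 0
  | 0, _, _ => rfl
  | n + 1, c, l => by simp [mean, mean_zero S n]

lemma mean_one (S : Strategy 𝓛) (hM : ∀ ν, IsPosterior ν → IsProbabilityMeasure (M ν)) :
    ∀ n c l, S.mean B M (fun _ => 1) n c l = 1
  | 0, _, _ => rfl
  | n + 1, c, l => by
    have := hM _ (S.isPosterior c)
    simp [mean, mean_one S hM n]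

end Strategy

/-- The cell of the number `t x = γ (1 - x) / x` in a partition of mesh `δ`; the cell `0` is that
of `x = 0`. -/
def oddsCell (γ δ : ℝ) (x : I) : ℕ :=
  if (x : ℝ) = 0 then 0 else ⌊γ * (1 - x) / x / δ⌋₊ + 1

lemma measurable_oddsCell (γ δ : ℝ) : Measurable (oddsCell γ δ) := by
  refine Measurable.ite ?_ measurable_const ?_
  · exact (measurableSet_singleton (0 : ℝ)).preimage measurable_subtype_coe
  · exact (Nat.measurable_floor.comp (by fun_prop)).add_const 1

/-- Adaptive composition with continuations that are chosen up to a countable partition. -/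
lemma lintegral_oddsCell_le {ν : Measure I} (hν : IsPosterior ν) {V : Measure EReal}
    (hV : IsPLD V) {γ : ℝ≥0∞} (hγ : γ ≠ ∞) {δ : ℝ} (hδ : 0 < δ) {a b : ℕ → ℝ≥0∞} (hb0 : b 0 = 0)
    (hab : ∀ m : ℕ, m ≠ 0 → a m + ENNReal.ofReal (m * δ) * b m
      ≤ risk V (ENNReal.ofReal (m * δ)) + ENNReal.ofReal δ) :
    ∫⁻ x, a (oddsCell γ.toReal δ x) ∂(fstM ν) + γ * ∫⁻ x, b (oddsCell γ.toReal δ x) ∂(sndM ν)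
      ≤ risk ((canonPLD ν).conv V) γ + ENNReal.ofReal (2 * δ) := by
  have := hν.fst
  have hd := measurable_oddsCell γ.toReal δ
  have ha : Measurable fun x => a (oddsCell γ.toReal δ x) := (Measurable.of_discrete (f := a)).comp hd
  have hb : Measurable fun x => b (oddsCell γ.toReal δ x) := (Measurable.of_discrete (f := b)).comp hd
  have hm : Measurable fun z : EReal => risk V (γ * EReal.exp (-z)) :=
    (measurable_risk V).comp (measurable_exp_neg.const_mul _)
  have hm' : Measurable fun x : I => risk V
      (γ * EReal.exp (-ENNReal.log (ENNReal.ofReal (x : ℝ) / ENNReal.ofReal (1 - (x : ℝ))))) :=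
    hm.comp measurable_log_odds
  have e1 : risk ((canonPLD ν).conv V) γ + ENNReal.ofReal (2 * δ) = ∫⁻ x : I, (risk V
      (γ * EReal.exp (-ENNReal.log (ENNReal.ofReal (x : ℝ) / ENNReal.ofReal (1 - (x : ℝ)))))
      + ENNReal.ofReal (2 * δ)) ∂(fstM ν) := by
    rw [lintegral_add_right _ measurable_const, hν.isPLD.risk_conv hV, hν.canonPLD_eq_map,
      lintegral_map hm measurable_log_odds]
    simp
  rw [e1, fstM, sndM, lintegral_withDensity_eq_lintegral_mul _ measurable_ofReal_coe ha,
    lintegral_withDensity_eq_lintegral_mul _ measurable_ofReal_one_sub hb,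
    lintegral_withDensity_eq_lintegral_mul _ measurable_ofReal_coe (hm'.add_const _),
    ← lintegral_const_mul _ (measurable_ofReal_one_sub.mul hb),
    ← lintegral_add_left (measurable_ofReal_coe.mul ha)]
  refine lintegral_mono fun x => ?_
  simp only [Pi.mul_apply]
  rcases eq_or_lt_of_le x.2.1 with hx | hx
  -- At `x = 0` the first law has no mass and the updated weight is infinite; `b 0 = 0` makes both
  -- errors vanish.
  · have : oddsCell γ.toReal δ x = 0 := by rw [oddsCell, if_pos hx.symm]
    rw [this, hb0, ← hx]
    simp
  set m := oddsCell γ.toReal δ x with hmdef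
  have hx1 : 0 ≤ 1 - (x : ℝ) := sub_nonneg.2 x.2.2
  set t : ℝ := γ.toReal * (1 - x) / x with ht
  have ht0 : 0 ≤ t := by positivity
  have hm_eq : m = ⌊t / δ⌋₊ + 1 := by rw [hmdef, oddsCell, if_neg hx.ne']
  -- The weight is rounded up by at most `δ`: monotonicity of the test error and the Lipschitz bound
  -- of the risk cost one `δ`, near-optimality of the continuation another.
  have hmt : t ≤ m * δ := by
    rw [← div_le_iff₀ hδ, hm_eq]
    push_cast
    exact (Nat.lt_floor_add_one _).le
  have hmt' : m * δ ≤ t + δ := by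
    have := Nat.floor_le (div_nonneg ht0 hδ.le)
    rw [le_div_iff₀ hδ] at this
    rw [hm_eq]
    push_cast
    linarith
  have hx0 : ENNReal.ofReal (x : ℝ) ≠ 0 := by simpa using hx
  have hodds : γ * EReal.exp (-ENNReal.log
      (ENNReal.ofReal (x : ℝ) / ENNReal.ofReal (1 - (x : ℝ)))) = ENNReal.ofReal t := by
    rw [EReal.exp_neg, ENNReal.exp_log,
      ENNReal.inv_div (Or.inl ENNReal.ofReal_ne_top) (Or.inr hx0), ← ENNReal.ofReal_div_of_pos hx,
      ← ENNReal.ofReal_toReal hγ, ← ENNReal.ofReal_mul ENNReal.toReal_nonneg, ht,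
      mul_div_assoc]
  have hxt : γ * ENNReal.ofReal (1 - (x : ℝ)) = ENNReal.ofReal (x : ℝ) * ENNReal.ofReal t := by
    rw [← ENNReal.ofReal_mul hx.le, ht, mul_div_cancel₀ _ hx.ne',
      ENNReal.ofReal_mul ENNReal.toReal_nonneg, ENNReal.ofReal_toReal hγ]
  rw [hodds, ← mul_assoc, hxt, mul_assoc, ← mul_add]
  refine mul_le_mul_right ?_ _
  calc a m + ENNReal.ofReal t * b m ≤ a m + ENNReal.ofReal (m * δ) * b m := by gcongr
    _ ≤ risk V (ENNReal.ofReal (m * δ)) + ENNReal.ofReal δ := hab m (by omega)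
    _ ≤ risk V (ENNReal.ofReal t + ENNReal.ofReal δ) + ENNReal.ofReal δ := by
        rw [← ENNReal.ofReal_add ht0 hδ.le]
        gcongr
        exact risk_mono V (ENNReal.ofReal_le_ofReal hmt')
    _ ≤ risk V (ENNReal.ofReal t) + ENNReal.ofReal δ + ENNReal.ofReal δ := by
        gcongr
        exact risk_add_le V hV.lintegral_exp_neg_le _ _
    _ = risk V (ENNReal.ofReal t) + ENNReal.ofReal (2 * δ) := by
        rw [add_assoc, ← ENNReal.ofReal_add hδ.le hδ.le, two_mul]

/-- The value is approximated by strategies. -/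
lemma exists_strategy {𝓛 : Set (Measure EReal)} (h𝓛 : ∀ L ∈ 𝓛, IsPLD L) (hId : idPLD ∈ 𝓛)
    (B : Measure EReal) :
    ∀ (n : ℕ) (l : List (Measure EReal)) {γ : ℝ≥0∞}, γ ≠ ∞ → ∀ {ε : ℝ}, 0 < ε →
      ∃ (S : Strategy 𝓛) (E : Set (List ℕ)), S.mean B fstM (Eᶜ.indicator 1) n [] l
        + γ * S.mean B sndM (E.indicator 1) n [] l
        ≤ risk (value 𝓛 B n l) γ + ENNReal.ofReal ε := by
  obtain ⟨ν₀, hν₀, hν₀'⟩ := isPLD_idPLD.exists_posterior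
  let S₀ : Strategy 𝓛 := ⟨fun _ => ν₀, fun _ _ => 0, fun _ => hν₀, fun _ => hν₀' ▸ hId,
    fun _ => measurable_const⟩
  -- Querying only `Id` and ignoring the answers reaches `min 1 γ` with one of the two constant
  -- tests.
  have hmin : ∀ n l (γ : ℝ≥0∞), ∃ E : Set (List ℕ), S₀.mean B fstM (Eᶜ.indicator 1) n [] l
      + γ * S₀.mean B sndM (E.indicator 1) n [] l ≤ min 1 γ := by
    intro n l γ
    rcases le_total 1 γ with h | h
    · refine ⟨∅, ?_⟩
      rw [Set.compl_empty, Set.indicator_univ, Set.indicator_empty, min_eq_left h]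
      have e1 := S₀.mean_one (B := B) (M := fstM) (fun ν h => h.fst) n [] l
      have e2 := S₀.mean_zero (B := B) (M := sndM) n [] l
      refine le_of_eq ?_
      rw [e2, mul_zero, add_zero]
      exact e1
    · refine ⟨Set.univ, ?_⟩
      rw [Set.compl_univ, Set.indicator_univ, Set.indicator_empty, min_eq_right h]
      have e1 := S₀.mean_zero (B := B) (M := fstM) n [] l
      have e2 := S₀.mean_one (B := B) (M := sndM) (fun ν h => h.snd) n [] l
      refine le_of_eq ?_
      rw [e1, zero_add]
      exact (congrArg (γ * ·) e2).trans (mul_one γ)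
  intro n
  induction n with
  | zero =>
    intro l γ _ ε _
    obtain ⟨E, hE⟩ := hmin 0 l γ
    exact ⟨S₀, E, hE.trans ((risk_idPLD γ).symm.le.trans le_self_add)⟩
  | succ n ih =>
    intro l γ hγ ε hε
    obtain ⟨R, hR, hle⟩ := exists_risk_le_risk_pldSup_add
      (isPLD_of_mem_value_family (B := B) h𝓛 n l) hγ (half_pos hε)
    rcases hR with ⟨L, hL, rfl⟩ | rfl
    · obtain ⟨ν, hν, rfl⟩ := (h𝓛 L hL.1).exists_posterior
      -- Composition loses `2 * δ = ε / 2`, and the choice of a near-optimal query the other half.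
      set δ := ε / 4 with hδ
      have hδ0 : 0 < δ := by positivity
      -- One continuation per cell, each near-optimal at the upper end of its cell.
      choose S E hSE using fun m : ℕ => ih (l ++ [canonPLD ν]) (γ := ENNReal.ofReal (m * δ))
        ENNReal.ofReal_ne_top hδ0
      -- The empty test after the cell `0` provides the condition `b 0 = 0`.
      let E' : ℕ → Set (List ℕ) := fun m => if m = 0 then ∅ else E m
      let S' := Strategy.cons ν hν hL.1 _ (measurable_oddsCell γ.toReal δ) S
      let F : Set (List ℕ) := {c | ∃ m c', c = m :: c' ∧ c' ∈ E' m}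
      have hF : ∀ m c, m :: c ∈ F ↔ c ∈ E' m := by
        intro m c
        constructor
        · rintro ⟨m', c', h, h'⟩
          rw [List.cons.injEq] at h
          rwa [h.1, h.2]
        · exact fun h => ⟨m, c, rfl, h⟩
      refine ⟨S', F, ?_⟩
      have hstep : ∀ (M : Measure I → Measure I) (leaf : List ℕ → ℝ≥0∞),
          S'.mean B M leaf (n + 1) [] l = ∫⁻ x, (S (oddsCell γ.toReal δ x)).mean B M
            (fun c => leaf (oddsCell γ.toReal δ x :: c)) n [] (l ++ [canonPLD ν]) ∂(M ν) := by
        intro M leaf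
        rw [Strategy.mean, if_pos (by exact hL.2)]
        refine lintegral_congr fun x => ?_
        exact Strategy.mean_cons hν hL.1 _ S _ n [] _
      have hFi : ∀ m, (fun c => F.indicator (1 : List ℕ → ℝ≥0∞) (m :: c)) = (E' m).indicator 1 := by
        intro m
        funext c
        by_cases h : c ∈ E' m
        · rw [Set.indicator_of_mem h, Set.indicator_of_mem ((hF m c).2 h)]; rfl
        · rw [Set.indicator_of_notMem h, Set.indicator_of_notMem (fun h' => h ((hF m c).1 h'))]
      have hFi' : ∀ m, (fun c => Fᶜ.indicator (1 : List ℕ → ℝ≥0∞) (m :: c))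
          = (E' m)ᶜ.indicator 1 := by
        intro m
        funext c
        by_cases h : c ∈ E' m
        · rw [Set.indicator_of_notMem (by simpa using (hF m c).2 h),
            Set.indicator_of_notMem (by simpa using h)]
        · rw [Set.indicator_of_mem (by simpa using fun h' => h ((hF m c).1 h')),
            Set.indicator_of_mem (by simpa using h)]; rfl
      rw [hstep, hstep]
      simp only [hFi, hFi']
      have hcomp := lintegral_oddsCell_le hν (isPLD_value 𝓛 B n (l ++ [canonPLD ν])) hγ hδ0
        (a := fun m => (S m).mean B fstM ((E' m)ᶜ.indicator 1) n [] (l ++ [canonPLD ν]))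
        (b := fun m => (S m).mean B sndM ((E' m).indicator 1) n [] (l ++ [canonPLD ν]))
        (by
          simp only [E', if_pos, Set.indicator_empty]
          exact (S 0).mean_zero n [] _)
        (by
          intro m hm
          simpa only [E', if_neg hm] using hSE m)
      refine hcomp.trans ?_
      calc _ ≤ risk (value 𝓛 B (n + 1) l) γ + ENNReal.ofReal (ε / 2) + ENNReal.ofReal (2 * δ) := by
            gcongr
            exact hle
        _ = _ := by
            rw [add_assoc, ← ENNReal.ofReal_add (by positivity) (by positivity), hδ]
            congr 2
            ring
    · obtain ⟨E, hE⟩ := hmin (n + 1) l γ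
      refine ⟨S₀, E, hE.trans ?_⟩
      rw [← risk_idPLD]
      refine hle.trans ?_
      rw [value]
      gcongr
      linarith

/-! ### Realizing strategies as analysts -/

/-- Relabelling the outcomes of a canonical pair does not change its PLD. -/
lemma pld_map_up {ν : Measure I} (hν : IsPosterior ν) :
    pld ((fstM ν).map (ULift.up : I → ULift.{u} I)) ((sndM ν).map ULift.up) = canonPLD ν := by
  have := hν.fst
  have := hν.snd
  have hdown : Measurable (ULift.down : ULift.{u} I → I) := measurable_down
  have hup : Measurable (ULift.up : I → ULift.{u} I) := measurable_up
  have key : ∀ w : I → ℝ≥0∞, Measurable w → (ν.withDensity w).map (ULift.up : I → ULift.{u} I)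
      = (ν.map ULift.up).withDensity fun z => w z.down := by
    intro w hw
    ext s hs
    rw [Measure.map_apply hup hs, withDensity_apply _ (hup hs), withDensity_apply _ hs,
      setLIntegral_map hs (show Measurable fun z : ULift.{u} I => w z.down from hw.comp hdown) hup]
  have k1 := key _ measurable_ofReal_coe
  have k2 := key _ measurable_ofReal_one_sub
  have i1 : IsProbabilityMeasure ((fstM ν).map (ULift.up : I → ULift.{u} I)) :=
    Measure.isProbabilityMeasure_map hup.aemeasurable
  have i2 : IsProbabilityMeasure ((sndM ν).map (ULift.up : I → ULift.{u} I)) :=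
    Measure.isProbabilityMeasure_map hup.aemeasurable
  rw [fstM] at i1
  rw [sndM] at i2
  rw [k1] at i1
  rw [k2] at i2
  have h := pld_withDensity (μ := ν.map (ULift.up : I → ULift.{u} I))
    (f := fun z => ENNReal.ofReal (z.down : ℝ)) (g := fun z => ENNReal.ofReal (1 - (z.down : ℝ)))
    (measurable_ofReal_coe.comp hdown) (measurable_ofReal_one_sub.comp hdown)
    (ae_of_all _ fun z => by finiteness)
  rw [← k1, ← k2] at h
  rw [fstM, sndM, h, hν.canonPLD_eq_map]
  exact Measure.map_map (measurable_log_odds.comp hdown) hup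

namespace Strategy

variable {𝓛 : Set (Measure EReal)}

/-- The cells recorded in a transcript; a refusal is recorded as the cell `0`. -/
def code (S : Strategy 𝓛) : (i : ℕ) → Transcript (fun _ => ULift.{u} I) i → List ℕ
  | 0, _ => []
  | i + 1, y => S.code i y.1 ++ [Sum.elim (fun w => S.cell (S.code i y.1) w.down) (fun _ => 0) y.2]

/-- The PLDs of the first `i` queries, when the cells `c` have been recorded. -/
def history (S : Strategy 𝓛) : ℕ → List ℕ → List (Measure EReal)
  | 0, _ => []
  | i + 1, c => S.history i c.dropLast ++ [canonPLD (S.post c.dropLast)]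

variable (S : Strategy 𝓛)

lemma history_concat (i : ℕ) (c : List ℕ) (m : ℕ) :
    S.history (i + 1) (c ++ [m]) = S.history i c ++ [canonPLD (S.post c)] := by
  rw [history, List.dropLast_concat]

/-- All sets of lists of cells are regarded as events. -/
local instance instMeasurableSpaceCells : MeasurableSpace (List ℕ) := ⊤

local instance instDiscreteMeasurableSpaceCells : DiscreteMeasurableSpace (List ℕ) :=
  ⟨fun _ => trivial⟩

/-- The queries and the decisions of the filter depend on the transcript through its code alone. As
codes form a countable discrete space, this makes the queries kernels and the decisions events. -/
lemma measurable_code : ∀ i, Measurable (S.code.{u} i)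
  | 0 => measurable_const
  | i + 1 => by
    have h : Measurable fun p : List ℕ × (ULift.{u} I ⊕ Unit) =>
        p.1 ++ [Sum.elim (fun w => S.cell p.1 w.down) (fun _ => 0) p.2] := by
      refine measurable_from_prod_countable_right fun c => ?_
      refine (Measurable.of_discrete (f := fun m : ℕ => c ++ [m])).comp ?_
      exact Measurable.sumElim ((S.measurable_cell c).comp measurable_down) measurable_const
    exact h.comp (((measurable_code i).comp measurable_fst).prodMk measurable_snd)

variable {𝓓 : Type v} (D₁ D₂ : 𝓓)

open Classical in
/-- The distribution of the answers on the dataset `D`. -/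
def law (D : 𝓓) (ν : Measure I) : Measure I := if D = D₁ then fstM ν else sndM ν

variable {D₁ D₂} in
lemma isProbabilityMeasure_law (D : 𝓓) {ν : Measure I} (hν : IsPosterior ν) :
    IsProbabilityMeasure (law D₁ D ν) := by
  unfold law
  split_ifs
  · exact hν.fst
  · exact hν.snd

/-- The analyst that never stops and issues the queries of the strategy. -/
def analyst (hD : D₁ ≠ D₂) : Analyst.{u, v} D₁ D₂ 𝓛 where
  Y := fun _ => ULift.{u} I
  continues := fun _ => Set.univ
  query := fun i D =>
    { toFun := fun y => (law D₁ D (S.post (S.code i y))).map ULift.up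
      measurable' := (Measurable.of_discrete
        (f := fun c => (law D₁ D (S.post c)).map (ULift.up : I → ULift.{u} I))).comp
        (S.measurable_code i) }
  isMarkov := fun i D => ⟨fun y =>
    have := isProbabilityMeasure_law (D₁ := D₁) D (S.isPosterior (S.code i y))
    Measure.isProbabilityMeasure_map measurable_up.aemeasurable⟩
  query_mem := fun i y => by
    change pld ((law D₁ D₁ (S.post (S.code i y))).map ULift.up)
      ((law D₁ D₂ (S.post (S.code i y))).map ULift.up) ∈ 𝓛
    rw [law, law, if_pos rfl, if_neg hD.symm, pld_map_up (S.isPosterior _)]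
    exact S.mem _

variable {D₁ D₂} (hD : D₁ ≠ D₂) {B : Measure EReal}

lemma queryPLD_analyst (i : ℕ) (y : Transcript (fun _ => ULift.{u} I) i) :
    (S.analyst D₁ D₂ hD).queryPLD i y = canonPLD (S.post (S.code i y)) := by
  change pld ((law D₁ D₁ (S.post (S.code i y))).map ULift.up)
      ((law D₁ D₂ (S.post (S.code i y))).map ULift.up) = _
  rw [law, law, if_pos rfl, if_neg hD.symm, pld_map_up (S.isPosterior _)]

lemma issued_analyst : ∀ (i : ℕ) (y : Transcript (fun _ => ULift.{u} I) i),
    (S.analyst D₁ D₂ hD).issued i y = S.history i (S.code i y)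
  | 0, _ => rfl
  | i + 1, y => by
    have h1 := issued_analyst i y.1
    have h2 := S.queryPLD_analyst hD i y.1
    change (S.analyst D₁ D₂ hD).issued i y.1 ++ [(S.analyst D₁ D₂ hD).queryPLD i y.1] = _
    rw [h1, h2, code, history_concat]

lemma running_analyst : ∀ (i : ℕ) (y : Transcript (fun _ => ULift.{u} I) i),
    (S.analyst D₁ D₂ hD).running i y
  | 0, _ => trivial
  | i + 1, y => ⟨running_analyst i y.1, trivial⟩

lemma mem_answered_analyst (i : ℕ) (y : Transcript (fun _ => ULift.{u} I) i) :
    y ∈ (S.analyst D₁ D₂ hD).answered B i ↔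
      PLDLE ((convList (S.history i (S.code i y))).conv (canonPLD (S.post (S.code i y)))) B := by
  have h1 := S.issued_analyst hD i y
  have h2 := S.queryPLD_analyst hD i y
  rw [← convList_append_singleton, ← h1, ← h2]
  exact ⟨fun h => h.2, fun h => ⟨S.running_analyst hD i y, h⟩⟩

lemma measurableDecisions_analyst : (S.analyst.{u, v} D₁ D₂ hD).MeasurableDecisions B := by
  intro i
  have h : (S.analyst D₁ D₂ hD).answered B i = S.code i ⁻¹'
      {c | PLDLE ((convList (S.history i c)).conv (canonPLD (S.post c))) B} :=
    Set.ext fun y => S.mem_answered_analyst hD i y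
  rw [h]
  exact S.measurable_code i trivial

/-- The interaction unfolds from its last round and `mean` from its first. Moving one round at a
time from the measure into the integrand reconciles them; `n = 0` with an indicator leaf gives the
probability of a test. -/
lemma lintegral_interaction_analyst (D : 𝓓) (leaf : List ℕ → ℝ≥0∞) (i : ℕ) : ∀ n,
    ∫⁻ y, S.mean B (law D₁ D) leaf n (S.code i y) (S.history i (S.code i y))
      ∂((S.analyst.{u, v} D₁ D₂ hD).interaction B (S.measurableDecisions_analyst hD) D i)
    = S.mean B (law D₁ D) leaf (n + i) [] [] := by
  set hA := S.measurableDecisions_analyst (B := B) hD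
  have hmeas : ∀ i n, Measurable fun y : Transcript (fun _ => ULift.{u} I) i =>
      S.mean B (law D₁ D) leaf n (S.code i y) (S.history i (S.code i y)) := fun i n =>
    (Measurable.of_discrete
      (f := fun c => S.mean B (law D₁ D) leaf n c (S.history i c))).comp (S.measurable_code i)
  induction i with
  | zero =>
    intro n
    exact (S.analyst D₁ D₂ hD).lintegral_interaction_zero hA D (hmeas 0 n)
  | succ i ih =>
    intro n
    rw [show n + (i + 1) = (n + 1) + i by ring, ← ih (n + 1)]
    refine ((S.analyst D₁ D₂ hD).lintegral_interaction_succ hA D i (hmeas (i + 1) n)).trans ?_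
    refine lintegral_congr fun y => ?_
    have hmy := (hmeas (i + 1) n).comp ((S.analyst D₁ D₂ hD).measurable_transcript_mk i y)
    by_cases hy : y ∈ (S.analyst D₁ D₂ hD).answered B i
    · refine ((S.analyst D₁ D₂ hD).lintegral_response_of_mem hA D i hy hmy).trans ?_
      rw [mean, if_pos ((S.mem_answered_analyst hD i y).1 hy)]
      refine (lintegral_map (μ := law D₁ D (S.post (S.code i y))) (hmy.comp measurable_inl)
        measurable_up).trans (lintegral_congr fun x => ?_)
      exact congrArg _ (S.history_concat i (S.code i y) _)
    · refine ((S.analyst D₁ D₂ hD).lintegral_response_of_notMem hA D i hy hmy).trans ?_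
      rw [mean, if_neg fun h => hy ((S.mem_answered_analyst hD i y).2 h)]
      exact congrArg _ (S.history_concat i (S.code i y) _)

lemma interaction_analyst_apply (D : 𝓓) (k : ℕ) (E : Set (List ℕ)) :
    (S.analyst.{u, v} D₁ D₂ hD).interaction B (S.measurableDecisions_analyst hD) D k
      (S.code k ⁻¹' E) = S.mean B (law D₁ D) (E.indicator 1) k [] [] := by
  have h := S.lintegral_interaction_analyst (B := B) hD D (E.indicator 1) k 0
  rw [zero_add] at h
  rw [← h]
  exact (lintegral_indicator_one (S.measurable_code k (trivial : MeasurableSet E))).symm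

end Strategy

/-- If the filter is free, then the value is within the budget. -/
theorem value_pldLE_of_naturalFilterFree {𝓓 : Type v} {D₁ D₂ : 𝓓} (hD : D₁ ≠ D₂)
    {𝓛 : Set (Measure EReal)} (h𝓛 : ∀ L ∈ 𝓛, IsPLD L) (hId : idPLD ∈ 𝓛) {B : Measure EReal}
    (hB : IsPLD B) (k : ℕ) (hfree : NaturalFilterFree.{u, v} D₁ D₂ 𝓛 B k) :
    PLDLE (value 𝓛 B k []) B := by
  refine (pldLE_iff_risk_le (isPLD_value 𝓛 B k []) hB).2 fun γ hγ => ?_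
  refine ENNReal.le_of_forall_pos_le_add fun ε hε _ => ?_
  obtain ⟨S, E, hS⟩ := exists_strategy h𝓛 hId B k [] hγ (ε := ε) (by exact_mod_cast hε)
  have hle := (hfree (S.analyst D₁ D₂ hD) (S.measurableDecisions_analyst hD)).risk_le γ
  rw [ENNReal.ofReal_coe_nnreal] at hS
  have hE := S.interaction_analyst_apply hD (B := B) D₂ k E
  have hE' := S.interaction_analyst_apply hD (B := B) D₁ k Eᶜ
  rw [show Strategy.law D₁ D₁ = fstM from funext fun ν => if_pos rfl] at hE'
  rw [show Strategy.law D₁ D₂ = sndM from funext fun ν => if_neg hD.symm] at hE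
  -- By freeness the risk of `B` is at most that of this interaction, hence at most the error of the
  -- test `E` on the recorded cells.
  refine hle.trans (le_trans ?_ hS)
  rw [← hE, ← hE']
  exact risk_pld_le_test (P := (S.analyst D₁ D₂ hD).interaction B _ D₁ k)
    (Q := (S.analyst D₁ D₂ hD).interaction B _ D₂ k) γ (S.measurable_code k trivial)

end Privacy
end

theorem mainTheorem3 {𝓓 : Type v} (D₁ D₂ : 𝓓) (hD : D₁ ≠ D₂)
    (𝓛 : Set (Measure EReal)) (h𝓛 : ∀ L ∈ 𝓛, Privacy.IsPLD L) (hId : Privacy.idPLD ∈ 𝓛)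
    (B : Measure EReal) (hB : Privacy.IsPLD B) (k : ℕ) (hk : 0 < k) :
    (∀ (n : ℕ) (l : List (Measure EReal)), l.length + (n + 1) = k → (∀ L ∈ l, L ∈ 𝓛) →
      Privacy.PLDLE (Privacy.convList l) B →
      Privacy.IsPLDSup
        {R | ∃ L ∈ Privacy.admissible 𝓛 B l, R = L.conv (Privacy.value 𝓛 B n (l ++ [L]))}
        (Privacy.value 𝓛 B (n + 1) l)) ∧
    (Privacy.NaturalFilterFree.{u, v} D₁ D₂ 𝓛 B k ↔
      Privacy.PLDLE (Privacy.value 𝓛 B k []) B) := by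
  refine ⟨fun n l _ _ _ => Privacy.isPLDSup_value h𝓛 n l, fun h =>
    Privacy.value_pldLE_of_naturalFilterFree hD h𝓛 hId hB k h, fun h A hA =>
    (Privacy.Analyst.pldLE_value hA h𝓛 k).trans h⟩
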